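/- Let $L,l,\tau>0$, $\mathcal D_1=[-L,L]\times[-l,l]$, $\mathcal D_2=[-L,L]\times[0,\tau]$. Consider the target system $$w_t=w_{xx}+w_{yy}\ \text{ on }\mathcal D_1,\qquad w(\pm L,y,t)=0,\qquad w(x,l,t)=z_1(x,0,t),\qquad w(x,-l,t)=z_2(x,0,t),\qquad w(x,y,0)=w_0(x,y),$$ $$\partial_t z_i(x,s,t)=\partial_s z_i(x,s,t)\ \text{ on }\mathcal D_2,\qquad z_i(x,\tau,t)=0,\qquad z_i(x,s,0)=z_{i0}(x,s),\qquad i=1,2,$$ for $t\ge 0$. A solution is a triple with $w\in C([0,\infty);L^2(\mathcal D_1))$, $z_i\in C([0,\infty);H^1(\mathcal D_2))\cap C^1([0,\infty);L^2(\mathcal D_2))$ attaining the initial data such that, for every $t\ge0$, $\partial_t z_i(t)=\partial_s z_i(t)$ in $L^2(\mathcal D_2)$, $z_i(\cdot,\tau,t)=0$ in the sense of traces, and the heat equation with its boundary conditions holds in the very weak sense: for every $\varphi\in C^\infty(\mathbb R^2)$ vanishing on $\partial\mathcal D_1$, $$\frac{d}{dt}\int_{\mathcal D_1}w\,\varphi=\int_{\mathcal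 D_1}w\,\Delta\varphi-\int_{-L}^{L}z_1(x,0,t)\,\varphi_y(x,l)\,dx+\int_{-L}^{L}z_2(x,0,t)\,\varphi_y(x,-l)\,dx,$$ where $z_i(\cdot,0,t)\in L^2(-L,L)$ are traces. (Time derivatives at $t=0$ are one-sided.) The zero triple $(w,z_1,z_2)\equiv0$ is a solution (an equilibrium), and there exist constants $\alpha_2,\beta_2>0$, depending only on $L,l,\tau$, such that for all initial data $(w_0,z_{10},z_{20})\in L^2(\mathcal D_1)\times H^1(\mathcal D_2)\times H^1(\mathcal D_2)$ satisfying the compatibility conditions $z_{10}(\cdot,\tau)=0$ and $z_{20}(\cdot,\tau)=0$ (in the sense of traces), the system has a unique solution on $[0,\infty)$, and for all $t\ge0$ $$\|w(t)\|_{L^2}^2+\|z_1(t)\|_{H^1}^2+\|z_2(t)\|_{H^1}^2\le\alpha_2e^{-\beta_2t}\left(\|w_0\|_{L^2}^2+\|z_{10}\|_{H^1}^2+\|z_{20}\|_{H^1}^2\right),$$ where $\|g\|_{H^1}^2=\|g\|_{L^2}^2+\|g_x\|_{L^2}^2+\|g_s\|_{L^2}^2$. That is, the zero equilibrium is exponentially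 stable. -/

import Mathlib

open MeasureTheory Set
open scoped ContDiff ENNReal

noncomputable section

namespace TargetSystem

/-- The closed rectangle `[a, b] × [c, d]`. -/
def rect (a b c d : ℝ) : Set (ℝ × ℝ) := Icc a b ×ˢ Icc c d

/-- The space `L²([a, b] × [c, d])` of real functions (modulo a.e. equality), with its norm. -/
abbrev L2Rect (a b c d : ℝ) : Type := Lp ℝ 2 (volume.restrict (rect a b c d))

/-- The space `L²([a, b])` of real functions (modulo a.e. equality). -/
abbrev L2Seg (a b : ℝ) : Type := Lp ℝ 2 (volume.restrict (Icc a b))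

/-- Classical partial derivative with respect to the first variable. -/
def pd₁ (φ : ℝ × ℝ → ℝ) (p : ℝ × ℝ) : ℝ := fderiv ℝ φ p (1, 0)

/-- Classical partial derivative with respect to the second variable. -/
def pd₂ (φ : ℝ × ℝ → ℝ) (p : ℝ × ℝ) : ℝ := fderiv ℝ φ p (0, 1)

/-- Classical Laplacian in two variables. -/
def lap (φ : ℝ × ℝ → ℝ) (p : ℝ × ℝ) : ℝ := pd₁ (pd₁ φ) p + pd₂ (pd₂ φ) p

theorem continuous_pd₁ {φ : ℝ × ℝ → ℝ} (hφ : ContDiff ℝ ∞ φ) : Continuous (pd₁ φ) :=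
  (hφ.continuous_fderiv (by simp)).clm_apply continuous_const

theorem continuous_pd₂ {φ : ℝ × ℝ → ℝ} (hφ : ContDiff ℝ ∞ φ) : Continuous (pd₂ φ) :=
  (hφ.continuous_fderiv (by simp)).clm_apply continuous_const

theorem integrable_mul {a b c d : ℝ} (u : L2Rect a b c d) {ψ : ℝ × ℝ → ℝ}
    (hψ : Continuous ψ) :
    Integrable (fun p => u p * ψ p) (volume.restrict (rect a b c d)) := by
  have hK : IsCompact (rect a b c d) := isCompact_Icc.prod isCompact_Icc
  have : IsFiniteMeasure (volume.restrict (rect a b c d)) :=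
    ⟨by simpa using hK.measure_lt_top⟩
  have hu : IntegrableOn (fun p => u p) (rect a b c d) volume :=
    (Lp.memLp u).integrable (by norm_num)
  exact hu.mul_continuousOn hψ.continuousOn hK

/-- The Sobolev space `H¹` of the rectangle, as the graph of the weak gradient: a triple
`(u, u₁, u₂)` of `L²` functions such that `u₁` and `u₂` are the weak partial derivatives of `u`
with respect to the first and the second variable. (Weak derivatives are unique, so `u` determines
the triple; the subspace topology is the one of the usual `H¹` norm.) -/
def H1 (a b c d : ℝ) : Submodule ℝ (L2Rect a b c d × L2Rect a b c d × L2Rect a b c d) where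
  carrier := {u | ∀ φ : ℝ × ℝ → ℝ, ContDiff ℝ ∞ φ → HasCompactSupport φ →
    tsupport φ ⊆ Ioo a b ×ˢ Ioo c d →
    (∫ p in rect a b c d, u.1 p * pd₁ φ p = -∫ p in rect a b c d, u.2.1 p * φ p) ∧
    (∫ p in rect a b c d, u.1 p * pd₂ φ p = -∫ p in rect a b c d, u.2.2 p * φ p)}
  add_mem' := by
    intro u v hu hv φ h1 h2 h3
    have key : ∀ (f g : L2Rect a b c d) {ψ : ℝ × ℝ → ℝ}, Continuous ψ →
        ∫ p in rect a b c d, (f + g) p * ψ p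
          = (∫ p in rect a b c d, f p * ψ p) + ∫ p in rect a b c d, g p * ψ p := by
      intro f g ψ hψ
      rw [← integral_add (integrable_mul f hψ) (integrable_mul g hψ)]
      refine integral_congr_ae ?_
      filter_upwards [Lp.coeFn_add f g] with p hp
      rw [hp, Pi.add_apply, add_mul]
    obtain ⟨a1, a2⟩ := hu φ h1 h2 h3
    obtain ⟨b1, b2⟩ := hv φ h1 h2 h3
    simp only [Prod.fst_add, Prod.snd_add]
    rw [key _ _ (continuous_pd₁ h1), key _ _ (continuous_pd₂ h1), key _ _ h1.continuous,
      key _ _ h1.continuous, a1, a2, b1, b2]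
    constructor <;> ring
  zero_mem' := by
    intro φ _ _ _
    have key : ∀ ψ : ℝ × ℝ → ℝ,
        ∫ p in rect a b c d, (0 : L2Rect a b c d) p * ψ p = 0 := by
      intro ψ
      rw [integral_eq_zero_of_ae]
      filter_upwards [Lp.coeFn_zero ℝ 2 (volume.restrict (rect a b c d))] with p hp
      rw [hp]; simp
    simp only [Prod.fst_zero, Prod.snd_zero]
    rw [key, key, key, neg_zero]
    exact ⟨rfl, rfl⟩
  smul_mem' := by
    intro r u hu φ h1 h2 h3
    have key : ∀ (f : L2Rect a b c d) (ψ : ℝ × ℝ → ℝ),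
        ∫ p in rect a b c d, (r • f) p * ψ p = r * ∫ p in rect a b c d, f p * ψ p := by
      intro f ψ
      rw [← integral_const_mul]
      refine integral_congr_ae ?_
      filter_upwards [Lp.coeFn_smul r f] with p hp
      rw [hp, Pi.smul_apply, smul_eq_mul, mul_assoc]
    obtain ⟨a1, a2⟩ := hu φ h1 h2 h3
    simp only [Prod.smul_fst, Prod.smul_snd]
    rw [key, key, key, key, a1, a2]
    constructor <;> ring

variable {a b c d : ℝ}

/-- The underlying `L²` function of an element of `H¹`. -/
def h1Fn (u : H1 a b c d) : L2Rect a b c d := u.1.1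

/-- The weak partial derivative with respect to the first variable. -/
def h1Wd₁ (u : H1 a b c d) : L2Rect a b c d := u.1.2.1

/-- The weak partial derivative with respect to the second variable. -/
def h1Wd₂ (u : H1 a b c d) : L2Rect a b c d := u.1.2.2

/-- The square of the `H¹` norm, `‖u‖²_{L²} + ‖u₁‖²_{L²} + ‖u₂‖²_{L²}`. -/
def h1NormSq (u : H1 a b c d) : ℝ := ‖h1Fn u‖ ^ 2 + ‖h1Wd₁ u‖ ^ 2 + ‖h1Wd₂ u‖ ^ 2

/-- `g ∈ L²([a, b])` is the trace of `u ∈ H¹([a, b] × [c, d])` on the edge where the second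
variable equals `c` (expressed by integration by parts in the second variable). -/
def HasLowerTrace (u : H1 a b c d) (g : L2Seg a b) : Prop :=
  ∀ φ : ℝ × ℝ → ℝ, ContDiff ℝ ∞ φ → (∀ x ∈ Icc a b, φ (x, d) = 0) →
    ∫ p in rect a b c d, (h1Fn u p * pd₂ φ p + h1Wd₂ u p * φ p) = -∫ x in Icc a b, g x * φ (x, c)

/-- `g ∈ L²([a, b])` is the trace of `u ∈ H¹([a, b] × [c, d])` on the edge where the second
variable equals `d` (expressed by integration by parts in the second variable). -/
def HasUpperTrace (u : H1 a b c d) (g : L2Seg a b) : Prop :=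
  ∀ φ : ℝ × ℝ → ℝ, ContDiff ℝ ∞ φ → (∀ x ∈ Icc a b, φ (x, c) = 0) →
    ∫ p in rect a b c d, (h1Fn u p * pd₂ φ p + h1Wd₂ u p * φ p) = ∫ x in Icc a b, g x * φ (x, d)

/-- `z`, a function of time `t ≥ 0` with values in `H¹([-L, L] × [0, τ])`, solves
`∂ₜ z(x,s,t) = ∂ₛ z(x,s,t)`, `z(x,τ,t) = 0`, `z(x,s,0) = z₀(x,s)`:
it is continuous into `H¹`, the equation holds in `L²` at every time `t ≥ 0` (with a one-sided
time derivative at `t = 0`), and the boundary condition holds in the sense of traces. -/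
structure IsTransportSolution (L τ : ℝ) (z₀ : H1 (-L) L 0 τ) (z : ℝ → H1 (-L) L 0 τ) :
    Prop where
  continuousOn : ContinuousOn z (Ici 0)
  initial : z 0 = z₀
  equation : ∀ t ∈ Ici (0 : ℝ), HasDerivWithinAt (fun r => h1Fn (z r)) (h1Wd₂ (z t)) (Ici 0) t
  boundary : ∀ t ∈ Ici (0 : ℝ), HasUpperTrace (z t) 0

/-- `w`, a function of time `t ≥ 0` with values in `L²([-L, L] × [-l, l])`, is the (very weak)
solution, i.e. the solution in the sense of transposition, of the heat equation
`w_t = w_xx + w_yy` with boundary data `w(±L,y,t) = 0`, `w(x,l,t) = g₁(t)(x)`,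
`w(x,-l,t) = g₂(t)(x)` and initial datum `w₀`: it is continuous into `L²`, and Green's formula
holds at every time `t ≥ 0` against every smooth function `φ` that vanishes on the boundary. -/
structure IsHeatSolution (L l : ℝ) (w₀ : L2Rect (-L) L (-l) l) (g₁ g₂ : ℝ → L2Seg (-L) L)
    (w : ℝ → L2Rect (-L) L (-l) l) : Prop where
  continuousOn : ContinuousOn w (Ici 0)
  initial : w 0 = w₀
  equation : ∀ φ : ℝ × ℝ → ℝ, ContDiff ℝ ∞ φ → (∀ p ∈ frontier (rect (-L) L (-l) l), φ p = 0) →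
    ∀ t ∈ Ici (0 : ℝ),
      HasDerivWithinAt (fun r => ∫ p in rect (-L) L (-l) l, w r p * φ p)
        ((∫ p in rect (-L) L (-l) l, w t p * lap φ p)
          - (∫ x in Icc (-L) L, g₁ t x * pd₂ φ (x, l))
          + ∫ x in Icc (-L) L, g₂ t x * pd₂ φ (x, -l))
        (Ici 0) t

/-- `(w, z₁, z₂)` is a solution on `[0, ∞)` of the target system with initial data
`(w₀, z₁₀, z₂₀)`: both `zᵢ` solve the transport system, and `w` solves the heat equation whose
boundary values at `y = l` and `y = -l` are the traces `z₁(x,0,t)` and `z₂(x,0,t)`. -/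
structure IsSolution (L l τ : ℝ) (w₀ : L2Rect (-L) L (-l) l) (z₁₀ z₂₀ : H1 (-L) L 0 τ)
    (w : ℝ → L2Rect (-L) L (-l) l) (z₁ z₂ : ℝ → H1 (-L) L 0 τ) : Prop where
  transport₁ : IsTransportSolution L τ z₁₀ z₁
  transport₂ : IsTransportSolution L τ z₂₀ z₂
  heat : ∃ g₁ g₂ : ℝ → L2Seg (-L) L,
    (∀ t ∈ Ici (0 : ℝ), HasLowerTrace (z₁ t) (g₁ t)) ∧
    (∀ t ∈ Ici (0 : ℝ), HasLowerTrace (z₂ t) (g₂ t)) ∧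
    IsHeatSolution L l w₀ g₁ g₂ w

end TargetSystem

end

noncomputable section

namespace TargetSystem

open Filter Topology

variable {a b c d : ℝ}

/-! The system is a cascade: the transport equations do not see `w`, and `w` sees them only through
their traces at `s = 0`. Each transport equation is solved by the left shift `z(x,s,t) = z₀(x,s+t)`,
extended by zero beyond `s = τ`. The vanishing upper trace of `z₀` keeps the extension in `H¹`
(`shift_mem_H1`), the shift is a contraction, and it is zero for `t ≥ τ`. Uniqueness is the energy
argument with `⟨z, ∂ₛz⟩ ≤ 0`.

For the heat equation the boundary data are moved inside by transposition. Rellich's identity bounds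
the normal derivative of a test function on a horizontal edge by `‖Δφ‖`, and the Laplacians of test
functions are dense in `L²`, so the adjoint of `Δφ ↦ φ_y` is a bounded Dirichlet map `D`
(`exists_dirichletMap`). The weak equation becomes `d/dt ⟨φ,w⟩ = ⟨Δφ, w - h⟩` with `h = D₁g₁ -
D₂g₂`. In the basis of Dirichlet sines it decouples into `wₙ' = -λₙ(wₙ - hₙ)`.

Since `λ ∫₀ᵗ e^{-λ(t-s)} ds ≤ 1`, the factor `λₙ` in front of the forcing costs nothing, provided
that the suprema over time of `|hₙ|` are square summable (`exists_diagonal_solution`). They are: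
`g(t)` is minus the integral of `∂ₛz₀` over `s > t`, so `|hₙ(t)|` is at most the integral over all
`s` of the `n`-th coefficient of the slice, and Cauchy–Schwarz in `s` with Bessel on each slice
gives the bound (`exists_coeff_bound`). For `t ≥ τ` the forcing is zero and `w` decays at the rate
of the spectral gap. Uniqueness holds because each sine is an admissible test function. -/

/-! ### Rectangles, pairings and test functions in `L²` -/

theorem measurableSet_rect (a b c d : ℝ) : MeasurableSet (rect a b c d) :=
  measurableSet_Icc.prod measurableSet_Icc

theorem isCompact_rect (a b c d : ℝ) : IsCompact (rect a b c d) :=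
  isCompact_Icc.prod isCompact_Icc

theorem restrict_rect (a b c d : ℝ) :
    (volume.restrict (rect a b c d) : Measure (ℝ × ℝ))
      = (volume.restrict (Icc a b)).prod (volume.restrict (Icc c d)) := by
  rw [rect, Measure.volume_eq_prod, Measure.prod_restrict]

instance isFiniteMeasure_restrict_rect (a b c d : ℝ) :
    IsFiniteMeasure (volume.restrict (rect a b c d)) :=
  ⟨by simpa using (isCompact_rect a b c d).measure_lt_top⟩

theorem memLp_rect {ψ : ℝ × ℝ → ℝ} (hψ : Continuous ψ) :
    MemLp ψ 2 (volume.restrict (rect a b c d)) := by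
  obtain ⟨C, hC⟩ := (isCompact_rect a b c d).exists_bound_of_continuousOn hψ.continuousOn
  exact MemLp.of_bound hψ.aestronglyMeasurable C
    ((ae_restrict_iff' (measurableSet_rect a b c d)).2 (.of_forall hC))

theorem memLp_seg {ψ : ℝ → ℝ} (hψ : Continuous ψ) :
    MemLp ψ 2 (volume.restrict (Icc a b)) := by
  obtain ⟨C, hC⟩ := (isCompact_Icc (a := a) (b := b)).exists_bound_of_continuousOn hψ.continuousOn
  exact MemLp.of_bound hψ.aestronglyMeasurable C
    ((ae_restrict_iff' measurableSet_Icc).2 (.of_forall hC))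

theorem setIntegral_rect_mul_eq_inner (u : L2Rect a b c d) {ψ : ℝ × ℝ → ℝ} (hψ : Continuous ψ) :
    ∫ p in rect a b c d, u p * ψ p = inner ℝ ((memLp_rect hψ).toLp ψ : L2Rect a b c d) u := by
  rw [L2.inner_def]
  refine integral_congr_ae ?_
  filter_upwards [(memLp_rect (a := a) (b := b) (c := c) (d := d) hψ).coeFn_toLp] with p hp
  rw [hp]; simp

theorem setIntegral_seg_mul_eq_inner (u : L2Seg a b) {ψ : ℝ → ℝ} (hψ : Continuous ψ) :
    ∫ x in Icc a b, u x * ψ x = inner ℝ ((memLp_seg hψ).toLp ψ : L2Seg a b) u := by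
  rw [L2.inner_def]
  refine integral_congr_ae ?_
  filter_upwards [(memLp_seg (a := a) (b := b) hψ).coeFn_toLp] with p hp
  rw [hp]; simp

theorem rect_ae_eq_interior (a b c d : ℝ) :
    (Ioo a b ×ˢ Ioo c d : Set (ℝ × ℝ)) =ᵐ[volume] rect a b c d := by
  rw [Measure.volume_eq_prod, rect]
  exact Measure.set_prod_ae_eq Ioo_ae_eq_Icc Ioo_ae_eq_Icc

/-- Test functions supported in the open rectangle separate the integrable functions. -/
theorem ae_eq_zero_of_forall_test {u : ℝ × ℝ → ℝ}
    (hint : Integrable u (volume.restrict (rect a b c d)))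
    (h : ∀ φ : ℝ × ℝ → ℝ, ContDiff ℝ ∞ φ → HasCompactSupport φ →
      tsupport φ ⊆ Ioo a b ×ˢ Ioo c d → ∫ p in rect a b c d, u p * φ p = 0) :
    u =ᵐ[volume.restrict (rect a b c d)] 0 := by
  have hU : IsOpen (Ioo a b ×ˢ Ioo c d : Set (ℝ × ℝ)) := isOpen_Ioo.prod isOpen_Ioo
  have hint : IntegrableOn u (rect a b c d) volume := hint
  have hsub : (Ioo a b ×ˢ Ioo c d : Set (ℝ × ℝ)) ⊆ rect a b c d :=
    prod_mono Ioo_subset_Icc_self Ioo_subset_Icc_self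
  have key := hU.ae_eq_zero_of_integral_contDiff_smul_eq_zero (f := u) (μ := volume)
    (hint.mono_set hsub).locallyIntegrableOn ?_
  · rw [EventuallyEq, ← ae_restrict_congr_set (rect_ae_eq_interior a b c d)] at *
    rw [ae_restrict_iff' hU.measurableSet]
    exact key
  · intro g g1 g2 g3
    rw [← h g g1 g2 g3, ← setIntegral_eq_integral_of_forall_compl_eq_zero (s := rect a b c d)]
    · simp only [smul_eq_mul, mul_comm]
    · intro x hx
      have : g x = 0 := by
        by_contra hne
        exact hx (hsub (g3 (subset_tsupport _ hne)))
      simp [this]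

/-- Test functions supported in the open rectangle separate the points of `L²`. -/
theorem eq_zero_of_forall_test (u : L2Rect a b c d)
    (h : ∀ φ : ℝ × ℝ → ℝ, ContDiff ℝ ∞ φ → HasCompactSupport φ →
      tsupport φ ⊆ Ioo a b ×ˢ Ioo c d → ∫ p in rect a b c d, u p * φ p = 0) : u = 0 :=
  (Lp.eq_zero_iff_ae_eq_zero).2
    (ae_eq_zero_of_forall_test ((Lp.memLp u).integrable (by norm_num)) h)

/-- A curve in `L²` whose pairings with test functions are differentiable, with derivatives given
by a continuous curve, is differentiable. -/
theorem hasDerivWithinAt_of_weak {F G : ℝ → L2Rect a b c d} (hG : Continuous G)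
    (h : ∀ φ : ℝ × ℝ → ℝ, ContDiff ℝ ∞ φ → HasCompactSupport φ →
      tsupport φ ⊆ Ioo a b ×ˢ Ioo c d → ∀ t ∈ Ici (0 : ℝ),
      HasDerivWithinAt (fun r => ∫ p in rect a b c d, F r p * φ p)
        (∫ p in rect a b c d, G t p * φ p) (Ici 0) t) {t : ℝ} (ht : 0 ≤ t) :
    HasDerivWithinAt F (G t) (Ici 0) t := by
  have hI : ∀ r, HasDerivAt (fun t => ∫ s in (0 : ℝ)..t, G s) (G r) r := fun r =>
    intervalIntegral.integral_hasDerivAt_right (hG.intervalIntegrable _ _)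
      hG.aestronglyMeasurable.stronglyMeasurableAtFilter hG.continuousAt
  -- Weak differentiability is upgraded through the integrated form: the pairing of `F r - F 0 - ∫
  -- G` with a test function has zero derivative, so this vector is zero.
  have key : ∀ r ∈ Ici (0 : ℝ), F r = F 0 + ∫ s in (0 : ℝ)..r, G s := by
    intro r hr
    rw [← sub_eq_zero]
    refine eq_zero_of_forall_test _ fun φ h1 h2 h3 => ?_
    rw [setIntegral_rect_mul_eq_inner _ h1.continuous]
    set e := ((memLp_rect h1.continuous).toLp φ : L2Rect a b c d)
    have hd : ∀ s ∈ Ici (0 : ℝ), HasDerivWithinAt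
        (fun r => inner ℝ e (F r - (F 0 + ∫ s in (0 : ℝ)..r, G s))) 0 (Ici 0) s := by
      intro s hs
      have h4 := h φ h1 h2 h3 s hs
      simp only [setIntegral_rect_mul_eq_inner _ h1.continuous] at h4
      have h5 : HasDerivWithinAt (fun t => inner ℝ e (F 0 + ∫ s in (0 : ℝ)..t, G s))
          (inner ℝ e (G s)) (Ici 0) s := by
        have := ((hI s).const_add (F 0)).hasDerivWithinAt (s := Ici 0)
        simpa using (hasDerivWithinAt_const s (Ici (0 : ℝ)) e).inner ℝ this
      have h6 := h4.sub h5
      rw [sub_self] at h6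
      simp only [inner_sub_right]
      exact h6
    have := (convex_Ici (0 : ℝ)).is_const_of_fderivWithin_eq_zero (𝕜 := ℝ)
      (fun s hs => (hd s hs).differentiableWithinAt) (fun s hs => ?_) hr (self_mem_Ici (a := (0:ℝ)))
    · rw [this]; simp
    · have h7 := (hd s hs).hasFDerivWithinAt.fderivWithin
        ((uniqueDiffOn_Ici (0 : ℝ)) s hs)
      rw [h7]; ext; simp
  refine HasDerivWithinAt.congr ((hI t).const_add (F 0)).hasDerivWithinAt key (key t ht)

/-! ### The shift in the second variable -/

/-- Extension by zero from a rectangle to the plane. -/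
def extendZero (f : L2Rect a b c d) : Lp ℝ 2 (volume : Measure (ℝ × ℝ)) :=
  ((memLp_indicator_iff_restrict (measurableSet_rect a b c d)).2 (Lp.memLp f)).toLp _

theorem extendZero_coeFn (f : L2Rect a b c d) :
    extendZero f =ᵐ[volume] (rect a b c d).indicator f := MemLp.coeFn_toLp _

theorem norm_extendZero (f : L2Rect a b c d) : ‖extendZero f‖ = ‖f‖ := by
  rw [extendZero, Lp.norm_toLp, eLpNorm_indicator_eq_eLpNorm_restrict (measurableSet_rect a b c d),
    Lp.norm_def]

/-- The translation `(x, s) ↦ (x, s + t)` of the plane. -/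
def vShift (t : ℝ) : C(ℝ × ℝ, ℝ × ℝ) := ⟨fun p => (p.1, p.2 + t), by fun_prop⟩

theorem vShift_apply (t : ℝ) (p : ℝ × ℝ) : vShift t p = (p.1, p.2 + t) := rfl

theorem vShift_eq_add (t : ℝ) : ⇑(vShift t) = fun p => p + ((0 : ℝ), t) := by
  funext p; ext <;> simp [vShift_apply]

theorem measurePreserving_vShift (t : ℝ) :
    MeasurePreserving (vShift t) (volume : Measure (ℝ × ℝ)) volume := by
  rw [vShift_eq_add]
  exact measurePreserving_add_right volume ((0 : ℝ), t)

theorem continuous_vShift : Continuous vShift := by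
  refine ContinuousMap.continuous_of_continuous_uncurry _ ?_
  simp only [Function.uncurry_def, vShift_apply]
  fun_prop

/-- The left shift in the second variable, with zero inflow. -/
def shift (t : ℝ) (f : L2Rect a b c d) : L2Rect a b c d :=
  LpToLpRestrictCLM (ℝ × ℝ) ℝ ℝ volume 2 (rect a b c d)
    (Lp.compMeasurePreserving (vShift t) (measurePreserving_vShift t) (extendZero f))

theorem shift_coeFn (t : ℝ) (f : L2Rect a b c d) :
    shift t f =ᵐ[volume.restrict (rect a b c d)]
      fun p => (rect a b c d).indicator f (p.1, p.2 + t) := by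
  have h1 := (measurePreserving_vShift t).quasiMeasurePreserving.ae_eq_comp (extendZero_coeFn f)
  have h2 := Lp.coeFn_compMeasurePreserving (extendZero f) (measurePreserving_vShift t)
  filter_upwards [LpToLpRestrictCLM_coeFn ℝ (rect a b c d)
    (Lp.compMeasurePreserving (vShift t) (measurePreserving_vShift t) (extendZero f)),
    ae_restrict_of_ae h1, ae_restrict_of_ae h2] with p hp1 hp2 hp3
  rw [shift, hp1, hp3, hp2]; rfl

theorem continuous_shift (f : L2Rect a b c d) : Continuous fun t => shift t f :=
  (ContinuousLinearMap.continuous _).comp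
    (continuous_const.compMeasurePreservingLp continuous_vShift measurePreserving_vShift (by simp))

theorem norm_shift_le (t : ℝ) (f : L2Rect a b c d) : ‖shift t f‖ ≤ ‖f‖ := by
  rw [← norm_extendZero f, ← Lp.norm_compMeasurePreserving (extendZero f)
    (measurePreserving_vShift t)]
  exact norm_Lp_toLp_restrict_le _ _

theorem shift_zero (f : L2Rect a b c d) : shift 0 f = f := by
  refine Lp.ext ?_
  filter_upwards [shift_coeFn 0 f, ae_restrict_mem (measurableSet_rect a b c d)] with p hp hm
  rw [hp, add_zero, indicator_of_mem hm]

theorem shift_eq_zero {t : ℝ} (ht : d - c ≤ t) (f : L2Rect a b c d) : shift t f = 0 := by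
  rw [Lp.eq_zero_iff_ae_eq_zero]
  -- When `t = d - c`, points of the edge `s = c` are still carried into the rectangle; they form a
  -- null set.
  have hne : ∀ᵐ p : ℝ × ℝ ∂(volume.restrict (rect a b c d)), p.2 ≠ c := by
    rw [restrict_rect]
    exact Measure.quasiMeasurePreserving_snd.ae (Measure.ae_ne _ c)
  filter_upwards [shift_coeFn t f, ae_restrict_mem (measurableSet_rect a b c d), hne]
    with p hp hm hc
  rw [hp, indicator_of_notMem]; · rfl
  rintro ⟨-, h2⟩
  have h3 := hm.2.1
  have : c < p.2 := lt_of_le_of_ne h3 (Ne.symm hc)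
  have := h2.2
  simp only at this
  linarith

/-- Translation invariance of Lebesgue measure. The only mismatch between the two domains comes from
points below the rectangle that the translation carries into it, and there `ψ` vanishes. -/
theorem integral_shift_mul {t : ℝ} (ht : 0 ≤ t) (f : L2Rect a b c d) {ψ : ℝ × ℝ → ℝ}
    (hψ : ∀ x ∈ Icc a b, ∀ s ≤ c, ψ (x, s) = 0) :
    ∫ p in rect a b c d, shift t f p * ψ p
      = ∫ p in rect a b c d, f p * ψ (p.1, p.2 - t) := by
  have h1 : ∫ p in rect a b c d, shift t f p * ψ p
      = ∫ p, (rect a b c d).indicator (fun p => (rect a b c d).indicator f (p.1, p.2 + t) * ψ p) p := by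
    rw [integral_indicator (measurableSet_rect a b c d)]
    refine integral_congr_ae ?_
    filter_upwards [shift_coeFn t f] with p hp
    rw [hp]
  have h2 := (measurePreserving_vShift t).integral_comp
    (by rw [vShift_eq_add]; exact (MeasurableEquiv.addRight ((0 : ℝ), t)).measurableEmbedding)
    ((rect a b c d).indicator fun p => f p * ψ (p.1, p.2 - t))
  rw [h1, ← integral_indicator (measurableSet_rect a b c d), ← h2]
  congr 1
  funext p
  rw [vShift_apply]
  by_cases hp : p ∈ rect a b c d
  · rw [indicator_of_mem hp]
    by_cases hq : (p.1, p.2 + t) ∈ rect a b c d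
    · rw [indicator_of_mem hq, indicator_of_mem hq]; simp
    · rw [indicator_of_notMem hq, indicator_of_notMem hq, zero_mul]
  · rw [indicator_of_notMem hp]
    by_cases hq : (p.1, p.2 + t) ∈ rect a b c d
    · rw [indicator_of_mem hq]
      have : p.2 ≤ c := by
        by_contra hc
        exact hp ⟨hq.1, (not_le.1 hc).le, by have := hq.2.2; simp only at this; linarith⟩
      simp only [add_sub_cancel_right]
      rw [hψ p.1 hq.1 _ this, mul_zero]
    · rw [indicator_of_notMem hq]

/-! ### Partial derivatives and smooth cutoffs -/

theorem hasDerivAt_fst {φ : ℝ × ℝ → ℝ} {x s : ℝ} (hφ : DifferentiableAt ℝ φ (x, s)) :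
    HasDerivAt (fun x => φ (x, s)) (pd₁ φ (x, s)) x :=
  hφ.hasFDerivAt.comp_hasDerivAt x ((hasDerivAt_id x).prodMk (hasDerivAt_const x s))

theorem hasDerivAt_snd {φ : ℝ × ℝ → ℝ} {x s : ℝ} (hφ : DifferentiableAt ℝ φ (x, s)) :
    HasDerivAt (fun s => φ (x, s)) (pd₂ φ (x, s)) s :=
  hφ.hasFDerivAt.comp_hasDerivAt s ((hasDerivAt_const s x).prodMk (hasDerivAt_id s))

theorem pd₁_eq {φ : ℝ × ℝ → ℝ} {x s v : ℝ} (hφ : DifferentiableAt ℝ φ (x, s))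
    (h : HasDerivAt (fun x => φ (x, s)) v x) : pd₁ φ (x, s) = v :=
  (hasDerivAt_fst hφ).unique h

theorem pd₂_eq {φ : ℝ × ℝ → ℝ} {x s v : ℝ} (hφ : DifferentiableAt ℝ φ (x, s))
    (h : HasDerivAt (fun s => φ (x, s)) v s) : pd₂ φ (x, s) = v :=
  (hasDerivAt_snd hφ).unique h

theorem contDiff_vShift_comp {φ : ℝ × ℝ → ℝ} (hφ : ContDiff ℝ ∞ φ) (t : ℝ) :
    ContDiff ℝ ∞ (fun p : ℝ × ℝ => φ (p.1, p.2 - t)) :=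
  hφ.comp (contDiff_fst.prodMk (contDiff_snd.sub contDiff_const))

theorem differentiableAt_of_smooth {φ : ℝ × ℝ → ℝ} (hφ : ContDiff ℝ ∞ φ) (p : ℝ × ℝ) :
    DifferentiableAt ℝ φ p := hφ.differentiable (by simp) p

theorem pd₁_vShift_comp {φ : ℝ × ℝ → ℝ} (hφ : ContDiff ℝ ∞ φ) (t : ℝ) (p : ℝ × ℝ) :
    pd₁ (fun p : ℝ × ℝ => φ (p.1, p.2 - t)) p = pd₁ φ (p.1, p.2 - t) :=
  pd₁_eq (x := p.1) (s := p.2) (differentiableAt_of_smooth (contDiff_vShift_comp hφ t) _)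
    (hasDerivAt_fst (x := p.1) (s := p.2 - t) (differentiableAt_of_smooth hφ _))

theorem pd₂_vShift_comp {φ : ℝ × ℝ → ℝ} (hφ : ContDiff ℝ ∞ φ) (t : ℝ) (p : ℝ × ℝ) :
    pd₂ (fun p : ℝ × ℝ => φ (p.1, p.2 - t)) p = pd₂ φ (p.1, p.2 - t) := by
  refine pd₂_eq (x := p.1) (s := p.2)
    (differentiableAt_of_smooth (contDiff_vShift_comp hφ t) _) ?_
  have h := hasDerivAt_snd (differentiableAt_of_smooth hφ (p.1, p.2 - t))
  have h2 := h.comp p.2 ((hasDerivAt_id p.2).sub_const t)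
  rw [mul_one] at h2
  exact h2

theorem contDiff_snd_mul {χ : ℝ → ℝ} (hχ : ContDiff ℝ ∞ χ) {φ : ℝ × ℝ → ℝ}
    (hφ : ContDiff ℝ ∞ φ) : ContDiff ℝ ∞ (fun p : ℝ × ℝ => χ p.2 * φ p) :=
  (hχ.comp contDiff_snd).mul hφ

theorem pd₁_snd_mul {χ : ℝ → ℝ} (hχ : ContDiff ℝ ∞ χ) {φ : ℝ × ℝ → ℝ}
    (hφ : ContDiff ℝ ∞ φ) (p : ℝ × ℝ) :
    pd₁ (fun p : ℝ × ℝ => χ p.2 * φ p) p = χ p.2 * pd₁ φ p :=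
  pd₁_eq (x := p.1) (s := p.2) (differentiableAt_of_smooth (contDiff_snd_mul hχ hφ) _)
    ((hasDerivAt_fst (x := p.1) (s := p.2) (differentiableAt_of_smooth hφ _)).const_mul (χ p.2))

theorem pd₂_snd_mul {χ : ℝ → ℝ} (hχ : ContDiff ℝ ∞ χ) {φ : ℝ × ℝ → ℝ}
    (hφ : ContDiff ℝ ∞ φ) (p : ℝ × ℝ) :
    pd₂ (fun p : ℝ × ℝ => χ p.2 * φ p) p = deriv χ p.2 * φ p + χ p.2 * pd₂ φ p :=
  pd₂_eq (x := p.1) (s := p.2) (differentiableAt_of_smooth (contDiff_snd_mul hχ hφ) _)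
    ((hχ.differentiable (by simp) p.2).hasDerivAt.mul
      (hasDerivAt_snd (differentiableAt_of_smooth hφ _)))

theorem contDiff_smoothTransition_comp (m k : ℝ) :
    ContDiff ℝ ∞ (fun s : ℝ => Real.smoothTransition (m * s + k)) :=
  (Real.smoothTransition.contDiff (n := ⊤)).comp
    ((contDiff_const.mul contDiff_id).add contDiff_const)

theorem deriv_smoothTransition_comp (m k s : ℝ) :
    deriv (fun s : ℝ => Real.smoothTransition (m * s + k)) s
      = m * deriv Real.smoothTransition (m * s + k) := by
  have h1 : DifferentiableAt ℝ Real.smoothTransition (m * s + k) :=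
    (Real.smoothTransition.contDiff (n := ⊤)).differentiable (by simp) _
  have h2 : HasDerivAt (fun s : ℝ => m * s + k) m s := by
    simpa using ((hasDerivAt_id s).const_mul m).add_const k
  rw [mul_comm]
  exact (h1.hasDerivAt.comp s h2).deriv

theorem deriv_smoothTransition_of_nonpos {y : ℝ} (hy : y ≤ 0) :
    deriv Real.smoothTransition y = 0 :=
  IsLocalMin.deriv_eq_zero <| .of_forall fun z => by
    rw [Real.smoothTransition.zero_of_nonpos hy]; exact Real.smoothTransition.nonneg z

theorem deriv_smoothTransition_of_one_le {y : ℝ} (hy : 1 ≤ y) :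
    deriv Real.smoothTransition y = 0 :=
  IsLocalMax.deriv_eq_zero <| .of_forall fun z => by
    rw [Real.smoothTransition.one_of_one_le hy]; exact Real.smoothTransition.le_one z

/-- The derivative of the cutoff `T(n(s - c))` grows like `n` but lives where `s - c` is of order
`1/n`. This bound keeps its product with a function of size `O(s - c)` bounded uniformly in `n`. -/
theorem exists_bound_mul_deriv_smoothTransition :
    ∃ C : ℝ, 0 ≤ C ∧ ∀ y : ℝ, |y * deriv Real.smoothTransition y| ≤ C := by
  have hc : Continuous fun y : ℝ => y * deriv Real.smoothTransition y :=
    continuous_id.mul ((Real.smoothTransition.contDiff (n := ⊤)).continuous_deriv (by simp))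
  obtain ⟨C, hC⟩ := (isCompact_Icc (a := (0 : ℝ)) (b := 1)).exists_bound_of_continuousOn
    hc.continuousOn
  refine ⟨max C 0, le_max_right _ _, fun y => ?_⟩
  by_cases h0 : y ≤ 0
  · simp [deriv_smoothTransition_of_nonpos h0]
  by_cases h1 : 1 ≤ y
  · simp [deriv_smoothTransition_of_one_le h1]
  · exact (hC y ⟨(not_le.1 h0).le, (not_le.1 h1).le⟩).trans (le_max_left _ _)

theorem exists_bound_rect (ψ : ℝ × ℝ → ℝ) (hψ : Continuous ψ) (a b c d : ℝ) :
    ∃ C : ℝ, 0 ≤ C ∧ ∀ p ∈ rect a b c d, |ψ p| ≤ C := by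
  obtain ⟨C, hC⟩ := (isCompact_rect a b c d).exists_bound_of_continuousOn hψ.continuousOn
  exact ⟨max C 0, le_max_right _ _, fun p hp => (hC p hp).trans (le_max_left _ _)⟩

theorem integrable_rect (u : L2Rect a b c d) :
    Integrable (fun p => u p) (volume.restrict (rect a b c d)) :=
  (Lp.memLp u).integrable (by norm_num)

theorem ae_rect_snd_ne (a b c d e : ℝ) :
    ∀ᵐ p : ℝ × ℝ ∂(volume.restrict (rect a b c d)), p.2 ≠ e := by
  rw [restrict_rect]
  exact Measure.quasiMeasurePreserving_snd.ae (Measure.ae_ne _ e)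

/-! ### Enlarging the class of test functions by cutoffs -/

/-- A weak derivative in the second variable tested against functions vanishing below the rectangle
can be tested against functions vanishing on the lower edge. -/
theorem integral_eq_zero_of_lower_cutoff (u v : L2Rect a b c d)
    (h : ∀ ψ : ℝ × ℝ → ℝ, ContDiff ℝ ∞ ψ → (∀ x, ∀ s ≤ c, ψ (x, s) = 0) →
      (∀ x, ∀ s ≤ c, pd₂ ψ (x, s) = 0) →
      ∫ p in rect a b c d, (u p * pd₂ ψ p + v p * ψ p) = 0)
    {φ : ℝ × ℝ → ℝ} (hφ : ContDiff ℝ ∞ φ) (hφc : ∀ x ∈ Icc a b, φ (x, c) = 0) :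
    ∫ p in rect a b c d, (u p * pd₂ φ p + v p * φ p) = 0 := by
  obtain ⟨C, hC0, hC⟩ := exists_bound_mul_deriv_smoothTransition
  obtain ⟨K, hK0, hK⟩ := exists_bound_rect _ (continuous_pd₂ hφ) a b c d
  obtain ⟨N, hN0, hN⟩ := exists_bound_rect _ hφ.continuous a b c d
  set T := Real.smoothTransition with hT
  -- The cutoff is `T((n+1)(s - c))`: zero for `s ≤ c`, and eventually equal to `1` at each `s > c`.
  set χ : ℕ → ℝ → ℝ := fun n s => T (((n : ℝ) + 1) * s + (-(((n : ℝ) + 1) * c))) with hχ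
  have hχs : ∀ n, ContDiff ℝ ∞ (χ n) := fun n => contDiff_smoothTransition_comp _ _
  have hlow : ∀ (n : ℕ) (s : ℝ), s ≤ c → ((n : ℝ) + 1) * s + (-(((n : ℝ) + 1) * c)) ≤ 0 := by
    intro n s hs
    have : 0 ≤ ((n : ℝ) + 1) * (c - s) := by
      have : 0 ≤ c - s := by linarith
      positivity
    nlinarith
  have hψ : ∀ n, ContDiff ℝ ∞ (fun p : ℝ × ℝ => χ n p.2 * φ p) := fun n =>
    contDiff_snd_mul (hχs n) hφ
  have hd : ∀ n s, deriv (χ n) s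
      = ((n : ℝ) + 1) * deriv T (((n : ℝ) + 1) * s + (-(((n : ℝ) + 1) * c))) := fun n s =>
    deriv_smoothTransition_comp _ _ _
  have hzero : ∀ n : ℕ, ∫ p in rect a b c d, (u p * (deriv (χ n) p.2 * φ p + χ n p.2 * pd₂ φ p)
      + v p * (χ n p.2 * φ p)) = 0 := by
    intro n
    have := h _ (hψ n) ?_ ?_
    · simpa only [pd₂_snd_mul (hχs n) hφ] using this
    · intro x s hs
      simp only [hχ, hT, Real.smoothTransition.zero_of_nonpos (hlow n s hs), zero_mul]
    · intro x s hs
      rw [pd₂_snd_mul (hχs n) hφ, hd, hT, deriv_smoothTransition_of_nonpos (hlow n s hs)]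
      simp only [hχ, hT, Real.smoothTransition.zero_of_nonpos (hlow n s hs), zero_mul, mul_zero,
        add_zero]
  -- Vanishing on the lower edge makes `φ` of size `O(s - c)`, which absorbs the growth of the
  -- derivative of the cutoff and yields an integrable majorant.
  have hmv : ∀ p ∈ rect a b c d, |φ p| ≤ K * (p.2 - c) := by
    rintro ⟨x, s⟩ ⟨hx, hs⟩
    have h1 := (convex_Icc c d).norm_image_sub_le_of_norm_hasDerivWithin_le
      (f := fun s => φ (x, s)) (f' := fun s => pd₂ φ (x, s)) (C := K) (x := c) (y := s)
      (fun r _ => (hasDerivAt_snd (differentiableAt_of_smooth hφ _)).hasDerivWithinAt)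
      (fun r hr => hK (x, r) ⟨hx, hr⟩) ⟨le_rfl, hs.1.trans hs.2⟩ hs
    rw [hφc x hx, sub_zero, Real.norm_eq_abs, Real.norm_eq_abs] at h1
    rwa [abs_of_nonneg (a := s - c) (by linarith [hs.1])] at h1
  have hlim := tendsto_integral_of_dominated_convergence
    (μ := volume.restrict (rect a b c d))
    (F := fun (n : ℕ) (p : ℝ × ℝ) => u p * (deriv (χ n) p.2 * φ p + χ n p.2 * pd₂ φ p)
      + v p * (χ n p.2 * φ p)) (f := fun p => u p * pd₂ φ p + v p * φ p)
    (fun p => |u p| * (C * K + K) + |v p| * N) ?_ ?_ ?_ ?_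
  · simp only [hzero] at hlim
    exact tendsto_nhds_unique hlim tendsto_const_nhds
  · intro n
    have h1 := (hχs n).continuous_deriv (by simp)
    have h2 := (hχs n).continuous
    have h3 := continuous_pd₂ hφ
    have h4 := hφ.continuous
    exact ((integrable_rect u).aestronglyMeasurable.mul
      (Continuous.aestronglyMeasurable (by fun_prop))).add
      ((integrable_rect v).aestronglyMeasurable.mul
      (Continuous.aestronglyMeasurable (by fun_prop)))
  · exact ((integrable_rect u).abs.mul_const _).add ((integrable_rect v).abs.mul_const _)
  · intro n
    filter_upwards [ae_restrict_mem (measurableSet_rect a b c d)] with p hp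
    have hT1 : |χ n p.2| ≤ 1 := by
      rw [abs_of_nonneg (Real.smoothTransition.nonneg _)]
      exact Real.smoothTransition.le_one _
    have h1 : |deriv (χ n) p.2 * φ p| ≤ C * K := by
      rw [hd, abs_mul]
      have hpc : 0 ≤ p.2 - c := by linarith [hp.2.1]
      have h2 := hC (((n : ℝ) + 1) * p.2 + (-(((n : ℝ) + 1) * c)))
      calc _ ≤ |((n : ℝ) + 1) * deriv T (((n : ℝ) + 1) * p.2 + (-(((n : ℝ) + 1) * c)))|
            * (K * (p.2 - c)) := by gcongr; exact hmv p hp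
        _ = |(((n : ℝ) + 1) * p.2 + (-(((n : ℝ) + 1) * c))) *
            deriv T (((n : ℝ) + 1) * p.2 + (-(((n : ℝ) + 1) * c)))| * K := by
          rw [abs_mul, abs_mul, show ((n : ℝ) + 1) * p.2 + (-(((n : ℝ) + 1) * c))
            = ((n : ℝ) + 1) * (p.2 - c) by ring, abs_mul, abs_of_nonneg hpc]
          ring
        _ ≤ C * K := by gcongr
    have h2 : |χ n p.2 * pd₂ φ p| ≤ K := by
      rw [abs_mul]
      calc _ ≤ 1 * K := by gcongr; exact hK p hp
        _ = K := one_mul K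
    have h3 : |χ n p.2 * φ p| ≤ N := by
      rw [abs_mul]
      calc _ ≤ 1 * N := by gcongr; exact hN p hp
        _ = N := one_mul N
    refine (norm_add_le _ _).trans (add_le_add ?_ ?_)
    · rw [Real.norm_eq_abs, abs_mul]
      gcongr
      exact (abs_add_le _ _).trans (add_le_add h1 h2)
    · rw [Real.norm_eq_abs, abs_mul]
      gcongr
  · filter_upwards [ae_restrict_mem (measurableSet_rect a b c d), ae_rect_snd_ne a b c d c]
      with p hp hpc
    have hpos : 0 < p.2 - c := sub_pos.2 (lt_of_le_of_ne hp.2.1 (Ne.symm hpc))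
    refine tendsto_const_nhds.congr' ?_
    obtain ⟨n₀, hn₀⟩ := exists_nat_gt (1 / (p.2 - c))
    filter_upwards [eventually_ge_atTop n₀] with n hn
    have hge : 1 ≤ ((n : ℝ) + 1) * p.2 + (-(((n : ℝ) + 1) * c)) := by
      have h1 : (n₀ : ℝ) ≤ n := by exact_mod_cast hn
      rw [div_lt_iff₀ hpos] at hn₀
      nlinarith
    rw [hd, hT, deriv_smoothTransition_of_one_le hge]
    simp only [hχ, hT, Real.smoothTransition.one_of_one_le hge]
    ring

/-- A weak derivative in the first variable may be tested against functions whose support reaches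
the upper edge. -/
theorem integral_pd₁_eq_of_upper_cutoff (u v : L2Rect a b c d)
    (h : ∀ φ : ℝ × ℝ → ℝ, ContDiff ℝ ∞ φ → HasCompactSupport φ →
      tsupport φ ⊆ Ioo a b ×ˢ Ioo c d →
      ∫ p in rect a b c d, u p * pd₁ φ p = -∫ p in rect a b c d, v p * φ p)
    {φ : ℝ × ℝ → ℝ} (hφ : ContDiff ℝ ∞ φ) (hcs : HasCompactSupport φ)
    (hsupp : tsupport φ ⊆ Ioo a b ×ˢ Ioi c) :
    ∫ p in rect a b c d, u p * pd₁ φ p = -∫ p in rect a b c d, v p * φ p := by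
  obtain ⟨K, hK0, hK⟩ := exists_bound_rect _ (continuous_pd₁ hφ) a b c d
  obtain ⟨N, hN0, hN⟩ := exists_bound_rect _ hφ.continuous a b c d
  set T := Real.smoothTransition with hT
  -- The cutoff is `T((n+1)(d - s) - 1)`. The `- 1` makes it vanish already for `s ≥ d - 1/(n+1)`,
  -- so that the closed support stays off the upper edge. It depends on `s` only, hence no
  -- derivative in the first variable falls on it.
  set χ : ℕ → ℝ → ℝ := fun n s => T ((-((n : ℝ) + 1)) * s + (((n : ℝ) + 1) * d - 1)) with hχ
  have hχs : ∀ n, ContDiff ℝ ∞ (χ n) := fun n => contDiff_smoothTransition_comp _ _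
  have hup : ∀ n, tsupport (fun p : ℝ × ℝ => χ n p.2) ⊆ {p | p.2 < d} := by
    intro n
    have hcl : IsClosed {p : ℝ × ℝ | p.2 ≤ d - 1 / ((n : ℝ) + 1)} :=
      isClosed_le continuous_snd continuous_const
    refine (closure_minimal ?_ hcl).trans fun p (hp : p.2 ≤ _) => ?_
    · intro p hp
      by_contra hne
      refine hp (Real.smoothTransition.zero_of_nonpos ?_)
      have h1 : d - 1 / ((n : ℝ) + 1) < p.2 := not_le.1 hne
      have hn : (0 : ℝ) < (n : ℝ) + 1 := by positivity
      have h2 : d - p.2 < 1 / ((n : ℝ) + 1) := by linarith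
      rw [lt_div_iff₀ hn] at h2
      nlinarith
    · have hn : (0 : ℝ) < 1 / ((n : ℝ) + 1) := by positivity
      exact lt_of_le_of_lt hp (by linarith)
  have heq : ∀ n : ℕ, ∫ p in rect a b c d, u p * (χ n p.2 * pd₁ φ p)
      = -∫ p in rect a b c d, v p * (χ n p.2 * φ p) := by
    intro n
    have := h (fun p => χ n p.2 * φ p) (contDiff_snd_mul (hχs n) hφ) hcs.mul_left ?_
    · simpa only [pd₁_snd_mul (hχs n) hφ] using this
    · intro p hp
      have h1 := hsupp (tsupport_mul_subset_right hp)
      exact ⟨h1.1, h1.2, hup n (tsupport_mul_subset_left hp)⟩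
  have hlim : ∀ (w : L2Rect a b c d) (ψ : ℝ × ℝ → ℝ), Continuous ψ → (C : ℝ) →
      (∀ p ∈ rect a b c d, |ψ p| ≤ C) →
      Tendsto (fun n => ∫ p in rect a b c d, w p * (χ n p.2 * ψ p)) atTop
        (𝓝 (∫ p in rect a b c d, w p * ψ p)) := by
    intro w ψ hψ C hC
    refine tendsto_integral_of_dominated_convergence (fun p => |w p| * C) ?_ ?_ ?_ ?_
    · intro n
      have h2 := (hχs n).continuous
      exact (integrable_rect w).aestronglyMeasurable.mul
        (Continuous.aestronglyMeasurable (by fun_prop))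
    · exact (integrable_rect w).abs.mul_const _
    · intro n
      filter_upwards [ae_restrict_mem (measurableSet_rect a b c d)] with p hp
      have hT1 : |χ n p.2| ≤ 1 := by
        rw [abs_of_nonneg (Real.smoothTransition.nonneg _)]
        exact Real.smoothTransition.le_one _
      rw [Real.norm_eq_abs, abs_mul, abs_mul]
      have := hC p hp
      calc |w p| * (|χ n p.2| * |ψ p|) ≤ |w p| * (1 * C) := by gcongr
        _ = _ := by ring
    · filter_upwards [ae_restrict_mem (measurableSet_rect a b c d), ae_rect_snd_ne a b c d d]
        with p hp hpd
      have hpos : 0 < d - p.2 := sub_pos.2 (lt_of_le_of_ne hp.2.2 hpd)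
      refine tendsto_const_nhds.congr' ?_
      obtain ⟨n₀, hn₀⟩ := exists_nat_gt (2 / (d - p.2))
      filter_upwards [eventually_ge_atTop n₀] with n hn
      have hge : 1 ≤ (-((n : ℝ) + 1)) * p.2 + (((n : ℝ) + 1) * d - 1) := by
        have h1 : (n₀ : ℝ) ≤ n := by exact_mod_cast hn
        rw [div_lt_iff₀ hpos] at hn₀
        nlinarith
      simp only [hχ, hT, Real.smoothTransition.one_of_one_le hge, one_mul]
  have h1 := hlim u _ (continuous_pd₁ hφ) K hK
  have h2 := (hlim v _ hφ.continuous N hN).neg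
  simp only [heq] at h1
  exact tendsto_nhds_unique h1 h2

/-! ### The transport equation: existence, contraction, uniqueness -/

theorem hasUpperTrace_zero_iff (u : H1 a b c d) : HasUpperTrace u 0 ↔
    ∀ φ : ℝ × ℝ → ℝ, ContDiff ℝ ∞ φ → (∀ x ∈ Icc a b, φ (x, c) = 0) →
      ∫ p in rect a b c d, (h1Fn u p * pd₂ φ p + h1Wd₂ u p * φ p) = 0 := by
  have h : ∀ φ : ℝ × ℝ → ℝ, ∫ x in Icc a b, (0 : L2Seg a b) x * φ (x, d) = 0 := by
    intro φ
    refine integral_eq_zero_of_ae ?_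
    filter_upwards [Lp.coeFn_zero ℝ 2 (volume.restrict (Icc a b))] with x hx
    rw [hx]; simp
  simp only [HasUpperTrace, h]

theorem integral_add_mul (u v : L2Rect a b c d) {ψ χ : ℝ × ℝ → ℝ} (hψ : Continuous ψ)
    (hχ : Continuous χ) : ∫ p in rect a b c d, (u p * ψ p + v p * χ p)
      = (∫ p in rect a b c d, u p * ψ p) + ∫ p in rect a b c d, v p * χ p :=
  integral_add (integrable_mul u hψ) (integrable_mul v hχ)

theorem HasUpperTrace.sub_zero {u v : H1 a b c d} (hu : HasUpperTrace u 0)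
    (hv : HasUpperTrace v 0) : HasUpperTrace (u - v) 0 := by
  rw [hasUpperTrace_zero_iff] at *
  intro φ h1 h2
  have hu := hu φ h1 h2
  have hv := hv φ h1 h2
  rw [integral_add_mul _ _ (continuous_pd₂ h1) h1.continuous,
    setIntegral_rect_mul_eq_inner _ (continuous_pd₂ h1),
    setIntegral_rect_mul_eq_inner _ h1.continuous] at *
  change inner ℝ _ (h1Fn u - h1Fn v) + inner ℝ _ (h1Wd₂ u - h1Wd₂ v) = 0
  rw [inner_sub_right, inner_sub_right]
  linarith

theorem eq_zero_of_tsupport {φ : ℝ × ℝ → ℝ} {s : Set (ℝ × ℝ)} (h : tsupport φ ⊆ s) {p : ℝ × ℝ}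
    (hp : p ∉ s) : φ p = 0 := by
  by_contra hne
  exact hp (h (subset_tsupport _ hne))

theorem tsupport_fderiv_apply_subset (φ : ℝ × ℝ → ℝ) (v : ℝ × ℝ) :
    tsupport (fun p => fderiv ℝ φ p v) ⊆ tsupport φ := by
  refine (closure_mono fun p hp => ?_).trans (tsupport_fderiv_subset (f := φ) ℝ)
  exact fun h0 => hp (by simp [h0])

/-- The shift is moved onto the test function as an upward translation. The translate is admissible
for the trace condition on `u` if the test function vanishes for all `s ≤ c`; the lower cutoff then
reduces the general case to this one. -/
theorem shift_upperTrace (u : H1 a b c d) (hu : HasUpperTrace u 0) {t : ℝ} (ht : 0 ≤ t)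
    {φ : ℝ × ℝ → ℝ} (hφ : ContDiff ℝ ∞ φ) (hφc : ∀ x ∈ Icc a b, φ (x, c) = 0) :
    ∫ p in rect a b c d, (shift t (h1Fn u) p * pd₂ φ p + shift t (h1Wd₂ u) p * φ p) = 0 := by
  refine integral_eq_zero_of_lower_cutoff _ _ (fun ψ h1 h2 h3 => ?_) hφ hφc
  rw [hasUpperTrace_zero_iff] at hu
  have h4 := hu _ (contDiff_vShift_comp h1 t) (fun x _ => h2 x _ (by simpa using ht))
  rw [integral_add_mul _ _ (continuous_pd₂ (contDiff_vShift_comp h1 t))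
    (contDiff_vShift_comp h1 t).continuous] at h4
  rw [integral_add_mul _ _ (continuous_pd₂ h1) h1.continuous,
    integral_shift_mul ht _ (fun x _ s hs => h3 x s hs),
    integral_shift_mul ht _ (fun x _ s hs => h2 x s hs)]
  simpa only [pd₂_vShift_comp h1] using h4

/-- Because the upper trace is zero, extension by zero creates no jump at the moving edge, hence no
singular part in the second derivative. For the first derivative the translated test function may
reach the upper edge, which the upper cutoff permits. -/
theorem shift_mem_H1 (u : H1 a b c d) (hu : HasUpperTrace u 0) {t : ℝ} (ht : 0 ≤ t) :
    (shift t (h1Fn u), shift t (h1Wd₁ u), shift t (h1Wd₂ u)) ∈ H1 a b c d := by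
  intro φ h1 h2 h3
  constructor
  · have h0 : ∀ x ∈ Icc a b, ∀ s ≤ c, φ (x, s) = 0 := fun x _ s hs =>
      eq_zero_of_tsupport h3 fun h => absurd h.2.1 (not_lt.2 hs)
    have h0' : ∀ x ∈ Icc a b, ∀ s ≤ c, pd₁ φ (x, s) = 0 := fun x _ s hs =>
      eq_zero_of_tsupport ((tsupport_fderiv_apply_subset φ _).trans h3)
        fun h => absurd h.2.1 (not_lt.2 hs)
    rw [integral_shift_mul ht _ h0', integral_shift_mul ht _ h0]
    have h4 := integral_pd₁_eq_of_upper_cutoff (h1Fn u) (h1Wd₁ u)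
      (fun φ h1 h2 h3 => (u.2 φ h1 h2 h3).1) (contDiff_vShift_comp h1 t) ?_ ?_
    · simpa only [pd₁_vShift_comp h1] using h4
    · have := h2.comp_homeomorph (Homeomorph.addRight ((0 : ℝ), -t))
      convert this using 1
      funext p; simp [sub_eq_add_neg, Prod.add_def]
    · have h5 : (fun p : ℝ × ℝ => φ (p.1, p.2 - t)) = φ ∘ Homeomorph.addRight ((0 : ℝ), -t) := by
        funext p; simp [sub_eq_add_neg, Prod.add_def]
      rw [h5, tsupport_comp_eq_preimage]
      intro p hp
      have h6 := h3 hp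
      simp only [Homeomorph.coe_addRight, mem_prod, Prod.fst_add, Prod.snd_add, add_zero] at h6
      exact ⟨h6.1, by have := h6.2.1; simp only [mem_Ioi]; linarith⟩
  · have h4 := shift_upperTrace u hu ht h1 fun x _ =>
      eq_zero_of_tsupport h3 fun h => absurd h.2.1 (lt_irrefl _)
    rw [integral_add_mul _ _ (continuous_pd₂ h1) h1.continuous] at h4
    simp only
    linarith

/-- Against a test function the time derivative falls on the translated test function as `-∂₂φ`, and
the zero upper trace turns this into `∂₂u`. The limit curve is continuous in `L²`, so the weak
derivative is a strong one. -/
theorem hasDerivWithinAt_shift (u : H1 a b c d) (hu : HasUpperTrace u 0) {t : ℝ} (ht : 0 ≤ t) :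
    HasDerivWithinAt (fun r => shift r (h1Fn u)) (shift t (h1Wd₂ u)) (Ici 0) t := by
  refine hasDerivWithinAt_of_weak (G := fun t => shift t (h1Wd₂ u)) (continuous_shift _)
    (fun φ h1 h2 h3 t ht => ?_) ht
  have ht : 0 ≤ t := ht
  have h0 : ∀ x ∈ Icc a b, ∀ s ≤ c, φ (x, s) = 0 := fun x _ s hs =>
    eq_zero_of_tsupport h3 fun h => absurd h.2.1 (not_lt.2 hs)
  obtain ⟨C, hC⟩ := (h2.fderiv_apply ℝ (0, 1)).exists_bound_of_continuous (continuous_pd₂ h1)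
  have hder := (hasDerivAt_integral_of_dominated_loc_of_deriv_le
    (μ := volume.restrict (rect a b c d)) (x₀ := t) (s := univ) (𝕜 := ℝ)
    (F := fun r p => h1Fn u p * φ (p.1, p.2 - r))
    (F' := fun r p => h1Fn u p * (-(pd₂ φ (p.1, p.2 - r))))
    (bound := fun p => |h1Fn u p| * C) univ_mem
    (.of_forall fun r => (integrable_mul _ (contDiff_vShift_comp h1 r).continuous).1)
    (integrable_mul _ (contDiff_vShift_comp h1 t).continuous)
    (integrable_mul _ (ψ := fun p => -(pd₂ φ (p.1, p.2 - t))) (by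
      have := continuous_pd₂ h1; fun_prop)).1
    (.of_forall fun p r _ => ?_) ((integrable_rect _).abs.mul_const _)
    (.of_forall fun p r _ => ?_)).2
  · have h4 : ∫ p in rect a b c d, h1Fn u p * (-(pd₂ φ (p.1, p.2 - t)))
        = ∫ p in rect a b c d, shift t (h1Wd₂ u) p * φ p := by
      rw [integral_shift_mul ht _ h0]
      have h5 := (hasUpperTrace_zero_iff u).1 hu _ (contDiff_vShift_comp h1 t)
        (fun x hx => h0 x hx _ (by simpa using ht))
      rw [integral_add_mul _ _ (continuous_pd₂ (contDiff_vShift_comp h1 t))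
        (contDiff_vShift_comp h1 t).continuous] at h5
      simp only [pd₂_vShift_comp h1] at h5
      simp only [mul_neg, integral_neg]
      linarith
    rw [h4] at hder
    exact hder.hasDerivWithinAt.congr (fun r hr => integral_shift_mul hr _ h0)
      (integral_shift_mul ht _ h0)
  · rw [Real.norm_eq_abs, abs_mul, abs_neg]
    gcongr
    exact hC _
  · have h4 := hasDerivAt_snd (differentiableAt_of_smooth h1 (p.1, p.2 - r))
    have h5 := h4.comp r ((hasDerivAt_id r).const_sub p.2)
    rw [mul_neg_one] at h5
    exact h5.const_mul _

/-- Twice the inner product is the right derivative at `0` of the squared norm of the shifted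
function, and the shift is a contraction. This is dissipativity without any integration by parts. -/
theorem inner_h1Wd₂_nonpos (u : H1 a b c d) (hu : HasUpperTrace u 0) :
    inner ℝ (h1Fn u) (h1Wd₂ u) ≤ 0 := by
  have h1 := (hasDerivWithinAt_shift u hu le_rfl).norm_sq
  rw [shift_zero, shift_zero] at h1
  by_contra hpos
  rw [not_le] at hpos
  have h2 := (hasDerivWithinAt_iff_tendsto_slope' (by simp)).1
    (h1.mono (Ioi_subset_Ici_self))
  have h3 : ∀ᶠ r in 𝓝[Ioi (0 : ℝ)] 0, slope (fun r => ‖shift r (h1Fn u)‖ ^ 2) 0 r ≤ 0 := by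
    filter_upwards [self_mem_nhdsWithin] with r hr
    have hr : (0 : ℝ) < r := hr
    rw [slope_def_field, shift_zero]
    refine div_nonpos_of_nonpos_of_nonneg ?_ (by linarith)
    have := norm_shift_le r (h1Fn u)
    have h0 := norm_nonneg (shift r (h1Fn u))
    nlinarith
  have := le_of_tendsto h2 h3
  linarith

theorem h1_ext_zero (u : H1 a b c d) (h : h1Fn u = 0) : u = 0 := by
  have hz : ∀ ψ : ℝ × ℝ → ℝ, ∫ p in rect a b c d, h1Fn u p * ψ p = 0 := by
    intro ψ
    rw [h]
    refine integral_eq_zero_of_ae ?_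
    filter_upwards [Lp.coeFn_zero ℝ 2 (volume.restrict (rect a b c d))] with x hx
    rw [hx]; simp
  have h1 : h1Wd₁ u = 0 := eq_zero_of_forall_test _ fun φ a1 a2 a3 => by
    have := (u.2 φ a1 a2 a3).1
    have h2 := hz (pd₁ φ)
    simp only [h1Fn, h1Wd₁] at *
    linarith
  have h2 : h1Wd₂ u = 0 := eq_zero_of_forall_test _ fun φ a1 a2 a3 => by
    have := (u.2 φ a1 a2 a3).2
    have h2 := hz (pd₂ φ)
    simp only [h1Fn, h1Wd₂] at *
    linarith
  exact Subtype.ext (Prod.ext h (Prod.ext h1 h2))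

/-- The solution of the transport equation with initial value `u`. -/
def transport (u : H1 a b c d) (hu : HasUpperTrace u 0) (t : ℝ) : H1 a b c d :=
  -- Negative times are frozen at `0`, which gives a curve continuous on the whole line.
  ⟨_, shift_mem_H1 u hu (le_max_right t 0)⟩

theorem h1NormSq_transport_le (u : H1 a b c d) (hu : HasUpperTrace u 0) (t : ℝ) :
    h1NormSq (transport u hu t) ≤ h1NormSq u := by
  have h : ∀ f : L2Rect a b c d, ‖shift (max t 0) f‖ ^ 2 ≤ ‖f‖ ^ 2 := fun f =>
    pow_le_pow_left₀ (norm_nonneg _) (norm_shift_le _ f) 2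
  exact add_le_add (add_le_add (h _) (h _)) (h _)

theorem h1NormSq_transport_eq_zero (u : H1 a b c d) (hu : HasUpperTrace u 0) {t : ℝ}
    (ht : d - c ≤ t) : h1NormSq (transport u hu t) = 0 := by
  have h : ∀ f : L2Rect a b c d, ‖shift (max t 0) f‖ ^ 2 = 0 := fun f => by
    rw [shift_eq_zero (ht.trans (le_max_left _ _))]; simp
  rw [h1NormSq]
  simp only [transport, h1Fn, h1Wd₁, h1Wd₂]
  rw [h, h, h]; simp

theorem isTransportSolution_transport {L τ : ℝ} (u : H1 (-L) L 0 τ) (hu : HasUpperTrace u 0) :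
    IsTransportSolution L τ u (transport u hu) where
  continuousOn := by
    refine Continuous.continuousOn (Continuous.subtype_mk ?_ _)
    have h : Continuous fun t : ℝ => max t 0 := by fun_prop
    exact ((continuous_shift _).comp h).prodMk
      (((continuous_shift _).comp h).prodMk ((continuous_shift _).comp h))
  initial := by
    refine Subtype.ext ?_
    simp only [transport, max_self, shift_zero]
    rfl
  equation := by
    intro t ht
    have h := hasDerivWithinAt_shift u hu ht
    have h2 : ∀ r ∈ Ici (0 : ℝ), h1Fn (transport u hu r) = shift r (h1Fn u) := fun r hr => by
      simp only [transport, h1Fn, max_eq_left (mem_Ici.1 hr)]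
    have h3 : h1Wd₂ (transport u hu t) = shift t (h1Wd₂ u) := by
      simp only [transport, h1Wd₂, max_eq_left (mem_Ici.1 ht)]
    rw [h3]
    exact h.congr h2 (h2 t ht)
  boundary := by
    intro t _
    rw [hasUpperTrace_zero_iff]
    intro φ h1 h2
    exact shift_upperTrace u hu (le_max_right t 0) h1 h2

/-- The difference has zero upper trace, so by dissipativity its squared `L²` norm does not increase
from its initial value `0`. -/
theorem IsTransportSolution.eqOn {L τ : ℝ} {u : H1 (-L) L 0 τ} {z z' : ℝ → H1 (-L) L 0 τ}
    (hz : IsTransportSolution L τ u z) (hz' : IsTransportSolution L τ u z') :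
    EqOn z z' (Ici 0) := by
  have hd : ∀ t ∈ Ici (0 : ℝ), HasDerivWithinAt (fun r => ‖h1Fn (z r - z' r)‖ ^ 2)
      (2 * inner ℝ (h1Fn (z t - z' t)) (h1Wd₂ (z t - z' t))) (Ici 0) t := fun t ht =>
    ((hz.equation t ht).sub (hz'.equation t ht)).norm_sq
  have hanti : AntitoneOn (fun r => ‖h1Fn (z r - z' r)‖ ^ 2) (Ici 0) := by
    refine antitoneOn_of_hasDerivWithinAt_nonpos (convex_Ici 0)
      (fun t ht => (hd t ht).continuousWithinAt)
      (fun t ht => (hd t (interior_subset ht)).mono interior_subset) fun t ht => ?_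
    have ht := interior_subset ht
    have := inner_h1Wd₂_nonpos _ ((hz.boundary t ht).sub_zero (hz'.boundary t ht))
    linarith
  intro t ht
  have h0 := hanti self_mem_Ici ht ht
  simp only [hz.initial, hz'.initial, sub_self] at h0
  have h1 : h1Fn (0 : H1 (-L) L 0 τ) = 0 := rfl
  rw [h1, norm_zero] at h0
  have h2 : h1Fn (z t - z' t) = 0 := by
    rw [← norm_eq_zero]
    have := norm_nonneg (h1Fn (z t - z' t))
    nlinarith
  exact sub_eq_zero.1 (h1_ext_zero _ h2)

/-! ### The lower trace, and coefficient bounds uniform in time -/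

theorem memLp_comp_fst (k : L2Seg a b) (c d : ℝ) :
    MemLp (fun p : ℝ × ℝ => k p.1) 2 (volume.restrict (rect a b c d)) := by
  rw [restrict_rect]
  exact (Lp.memLp k).comp_fst _

theorem norm_sq_eq_integral {α : Type*} [MeasurableSpace α] {μ : Measure α} (f : Lp ℝ 2 μ) :
    ‖f‖ ^ 2 = ∫ x, f x ^ 2 ∂μ := by
  rw [← real_inner_self_eq_norm_sq, L2.inner_def]
  refine integral_congr_ae (.of_forall fun x => ?_)
  simp [sq]

theorem norm_toLp_sq {α : Type*} [MeasurableSpace α] {μ : Measure α} {f : α → ℝ}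
    (hf : MemLp f 2 μ) : ‖hf.toLp f‖ ^ 2 = ∫ x, f x ^ 2 ∂μ := by
  rw [norm_sq_eq_integral]
  refine integral_congr_ae ?_
  filter_upwards [hf.coeFn_toLp] with x hx
  rw [hx]

theorem setIntegral_rect_swap {f : ℝ × ℝ → ℝ}
    (hf : Integrable f ((volume.restrict (Icc a b)).prod (volume.restrict (Icc c d)))) :
    ∫ p in rect a b c d, f p = ∫ s in Icc c d, ∫ x in Icc a b, f (x, s) := by
  rw [restrict_rect, integral_prod_symm _ hf]

/-- Functions of the first variable alone, as functions on the rectangle. -/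
def constSnd (a b c d : ℝ) : L2Seg a b →L[ℝ] L2Rect a b c d :=
  LinearMap.mkContinuous
    { toFun := fun k => (memLp_comp_fst k c d).toLp _
      map_add' := fun k k' => by
        rw [← MemLp.toLp_add]
        refine MemLp.toLp_congr _ _ ?_
        have h := Lp.coeFn_add k k'
        rw [restrict_rect]
        exact Measure.quasiMeasurePreserving_fst.ae_eq_comp h
      map_smul' := fun r k => by
        rw [RingHom.id_apply, ← MemLp.toLp_const_smul]
        refine MemLp.toLp_congr _ _ ?_
        have h := Lp.coeFn_smul r k
        rw [restrict_rect]
        exact Measure.quasiMeasurePreserving_fst.ae_eq_comp h }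
    (Real.sqrt ((volume.restrict (Icc c d)).real univ)) (by
      intro k
      refine abs_le_of_sq_le_sq (le_of_eq ?_) (by positivity) |> le_of_abs_le
      rw [mul_pow, Real.sq_sqrt measureReal_nonneg]
      simp only [LinearMap.coe_mk, AddHom.coe_mk]
      rw [norm_toLp_sq, norm_sq_eq_integral, restrict_rect]
      have h := integral_prod_mul (μ := volume.restrict (Icc a b)) (ν := volume.restrict (Icc c d))
        (fun x => k x ^ 2) (fun _ => (1 : ℝ))
      simp only [mul_one] at h
      rw [h, integral_const, smul_eq_mul, mul_one, mul_comm])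

theorem constSnd_coeFn (k : L2Seg a b) :
    constSnd a b c d k =ᵐ[volume.restrict (rect a b c d)] fun p => k p.1 :=
  MemLp.coeFn_toLp (memLp_comp_fst k c d)

/-- The trace on the lower edge of a function with vanishing trace on the upper edge. -/
def lowerTrace (ζ : L2Rect a b c d) : L2Seg a b := -(constSnd a b c d).adjoint ζ

/-- The adjoint of `constSnd` integrates out the second variable. With `ζ = ∂₂u` and `u(x,d) = 0`,
this is the fundamental theorem of calculus, `u(x,c) = -∫ ∂₂u(x,s) ds`. -/
theorem inner_lowerTrace (k : L2Seg a b) (ζ : L2Rect a b c d) :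
    inner ℝ k (lowerTrace ζ) = -∫ p in rect a b c d, ζ p * k p.1 := by
  rw [lowerTrace, inner_neg_right, ContinuousLinearMap.adjoint_inner_right, L2.inner_def]
  congr 1
  refine integral_congr_ae ?_
  filter_upwards [constSnd_coeFn (c := c) (d := d) k] with p hp
  rw [hp]; simp

theorem hasLowerTrace_lowerTrace (u : H1 a b c d) (hu : HasUpperTrace u 0) :
    HasLowerTrace u (lowerTrace (h1Wd₂ u)) := by
  intro φ h1 _
  have hφc : Continuous fun x => φ (x, c) := by have := h1.continuous; fun_prop
  -- Subtracting `φ(x,c)` leaves `∂₂φ` unchanged and makes the test function vanish on the lower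
  -- edge, so that the zero upper trace applies.
  have h0 : ContDiff ℝ ∞ fun p : ℝ × ℝ => φ (p.1, c) :=
    h1.comp (contDiff_fst.prodMk contDiff_const)
  have h2 := h1.sub h0
  have h3 := (hasUpperTrace_zero_iff u).1 hu _ h2 fun x _ => sub_self _
  have h4 : ∀ p : ℝ × ℝ, pd₂ (fun p : ℝ × ℝ => φ p - φ (p.1, c)) p = pd₂ φ p := fun p =>
    pd₂_eq (x := p.1) (s := p.2) (differentiableAt_of_smooth h2 _)
      ((hasDerivAt_snd (x := p.1) (s := p.2) (differentiableAt_of_smooth h1 _)).sub_const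
        (φ (p.1, c)))
  rw [integral_add_mul _ _ (continuous_pd₂ h2) h2.continuous] at h3
  simp only [h4, mul_sub] at h3
  rw [integral_sub (integrable_mul _ h1.continuous) (integrable_mul _ h0.continuous)] at h3
  rw [integral_add_mul _ _ (continuous_pd₂ h1) h1.continuous, setIntegral_seg_mul_eq_inner _ hφc,
    inner_lowerTrace]
  have h5 : ∫ p in rect a b c d, h1Wd₂ u p * ((memLp_seg hφc).toLp _ : L2Seg a b) p.1
      = ∫ p in rect a b c d, h1Wd₂ u p * φ (p.1, c) := by
    refine integral_congr_ae ?_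
    have := (memLp_seg (a := a) (b := b) hφc).coeFn_toLp
    have h6 := (Measure.quasiMeasurePreserving_fst
      (μ := volume.restrict (Icc a b)) (ν := volume.restrict (Icc c d))).ae_eq_comp this
    rw [← restrict_rect] at h6
    filter_upwards [h6] with p hp
    simp only [Function.comp_apply] at hp
    rw [hp]
  rw [h5]
  linarith

theorem continuous_lowerTrace : Continuous (lowerTrace (a := a) (b := b) (c := c) (d := d)) :=
  (ContinuousLinearMap.continuous _).neg

theorem integrable_mul_fst (ζ : L2Rect a b c d) (k : L2Seg a b) :
    Integrable (fun p : ℝ × ℝ => ζ p * k p.1)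
      ((volume.restrict (Icc a b)).prod (volume.restrict (Icc c d))) := by
  rw [← restrict_rect]
  exact (Lp.memLp ζ).integrable_mul (memLp_comp_fst k c d)

theorem integrable_sq_prod (ζ : L2Rect a b c d) :
    Integrable (fun p : ℝ × ℝ => ζ p ^ 2)
      ((volume.restrict (Icc a b)).prod (volume.restrict (Icc c d))) := by
  rw [← restrict_rect]
  exact (Lp.memLp ζ).integrable_sq

/-- Bessel's inequality on horizontal slices. -/
theorem ae_sum_slice_sq_le {ι : Type*} (k : ι → L2Seg a b) {C : ℝ}
    (hC : ∀ (F : Finset ι) (f : L2Seg a b), ∑ i ∈ F, inner ℝ (k i) f ^ 2 ≤ C * ‖f‖ ^ 2)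
    (ζ : L2Rect a b c d) (F : Finset ι) : ∀ᵐ s ∂(volume.restrict (Icc c d)),
      ∑ i ∈ F, (∫ x in Icc a b, ζ (x, s) * k i x) ^ 2 ≤ C * ∫ x in Icc a b, ζ (x, s) ^ 2 := by
  have hm : AEStronglyMeasurable (fun p => ζ p)
      ((volume.restrict (Icc a b)).prod (volume.restrict (Icc c d))) := by
    rw [← restrict_rect]; exact (Lp.memLp ζ).1
  filter_upwards [hm.prodMk_right, (integrable_sq_prod ζ).prod_left_ae] with s h1 h2
  have hs : MemLp (fun x => ζ (x, s)) 2 (volume.restrict (Icc a b)) :=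
    (memLp_two_iff_integrable_sq h1).2 h2
  have := hC F (hs.toLp _)
  rw [norm_toLp_sq] at this
  refine le_trans (le_of_eq ?_) this
  refine Finset.sum_congr rfl fun i _ => ?_
  rw [L2.inner_def]
  congr 1
  refine integral_congr_ae ?_
  filter_upwards [hs.coeFn_toLp] with x hx
  rw [hx]; simp

theorem integrable_slice_sq {ζ : L2Rect a b c d} {k : L2Seg a b} :
    Integrable (fun s => (∫ x in Icc a b, ζ (x, s) * k x) ^ 2) (volume.restrict (Icc c d)) := by
  have h := ae_sum_slice_sq_le (fun _ : Unit => k) (C := ‖k‖ ^ 2) (fun F f => ?_) ζ {()}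
  · refine Integrable.mono' ((integrable_sq_prod ζ).integral_prod_right.const_mul (‖k‖ ^ 2))
      ((integrable_mul_fst ζ k).integral_prod_right.1.pow 2) ?_
    filter_upwards [h] with s hs
    rw [Real.norm_eq_abs, abs_of_nonneg (by positivity)]
    simpa using hs
  · rw [← mul_pow, Finset.sum_const]
    have h1 : F.card ≤ 1 := Finset.card_le_one_of_subsingleton F
    have h2 : inner ℝ k f ^ 2 ≤ (‖k‖ * ‖f‖) ^ 2 :=
      sq_le_sq' (abs_le.1 (abs_real_inner_le_norm k f)).1 (abs_le.1 (abs_real_inner_le_norm k f)).2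
    interval_cases F.card
    · simp; positivity
    · simpa using h2

/-- Cauchy–Schwarz against the constant `1`, read off from the nonnegative integral of `(|q| - m)²`
with `m` the mean of `|q|`. -/
theorem sq_integral_abs_le {q : ℝ → ℝ} (hcd : c < d)
    (h1 : Integrable q (volume.restrict (Icc c d)))
    (h2 : Integrable (fun s => q s ^ 2) (volume.restrict (Icc c d))) :
    (∫ s in Icc c d, |q s|) ^ 2 ≤ (d - c) * ∫ s in Icc c d, q s ^ 2 := by
  have hpos : 0 < d - c := sub_pos.2 hcd
  set I := ∫ s in Icc c d, |q s|
  set m := I / (d - c)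
  have h3 : 0 ≤ ∫ s in Icc c d, (q s ^ 2 - 2 * m * |q s| + m ^ 2) :=
    integral_nonneg fun s => by
      have : q s ^ 2 - 2 * m * |q s| + m ^ 2 = (|q s| - m) ^ 2 := by rw [sub_sq, sq_abs]; ring
      simp only [this]; positivity
  have h3' : ∫ s in Icc c d, (q s ^ 2 - 2 * m * |q s| + m ^ 2)
      = (∫ s in Icc c d, q s ^ 2) - 2 * m * I + ∫ _ in Icc c d, m ^ 2 := by
    rw [← integral_const_mul, ← integral_sub h2 (h1.abs.const_mul _)]
    exact integral_add (h2.sub (h1.abs.const_mul (2 * m))) (integrable_const _)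
  rw [h3'] at h3
  simp only [integral_const, measureReal_restrict_apply_univ, Real.volume_real_Icc_of_le hcd.le,
    smul_eq_mul] at h3
  have h4 : m * (d - c) = I := div_mul_cancel₀ _ hpos.ne'
  have h5 : I ^ 2 = (d - c) * (2 * m * I - (d - c) * m ^ 2) := by
    rw [← h4]; ring
  rw [h5]
  gcongr
  linarith

/-- The coefficients of the boundary values of a transport solution are square summable uniformly
in time. -/
theorem exists_coeff_bound {ι : Type*} (k : ι → L2Seg a b) {C : ℝ}
    (hC : ∀ (F : Finset ι) (f : L2Seg a b), ∑ i ∈ F, inner ℝ (k i) f ^ 2 ≤ C * ‖f‖ ^ 2)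
    (hcd : c < d) (ζ : L2Rect a b c d) :
    ∃ A : ι → ℝ, (∀ i, 0 ≤ A i) ∧ (∀ F : Finset ι, ∑ i ∈ F, A i ^ 2 ≤ (d - c) * (C * ‖ζ‖ ^ 2)) ∧
      ∀ t, 0 ≤ t → ∀ i, |inner ℝ (k i) (lowerTrace (shift t ζ))| ≤ A i := by
  have hpos : 0 < d - c := sub_pos.2 hcd
  -- At time `t` the coefficient is an integral over the slices `s > c + t` only. Taking absolute
  -- values inside and integrating over all slices gives a majorant free of `t`, so the supremum in
  -- time comes before the sum over `i`.
  refine ⟨fun i => ∫ s in Icc c d, |∫ x in Icc a b, ζ (x, s) * k i x|,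
    fun i => integral_nonneg fun s => abs_nonneg _, fun F => ?_, fun t ht i => ?_⟩
  · have h1 : ∀ i, (∫ s in Icc c d, |∫ x in Icc a b, ζ (x, s) * k i x|) ^ 2
        ≤ (d - c) * ∫ s in Icc c d, (∫ x in Icc a b, ζ (x, s) * k i x) ^ 2 := fun i =>
      sq_integral_abs_le hcd (integrable_mul_fst ζ (k i)).integral_prod_right integrable_slice_sq
    refine (Finset.sum_le_sum fun i _ => h1 i).trans ?_
    rw [← Finset.mul_sum, ← integral_finsetSum _ fun i _ => integrable_slice_sq]
    gcongr
    calc _ ≤ ∫ s in Icc c d, C * ∫ x in Icc a b, ζ (x, s) ^ 2 :=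
          integral_mono_ae (integrable_finsetSum _ fun i _ => integrable_slice_sq)
            ((integrable_sq_prod ζ).integral_prod_right.const_mul C)
            (ae_sum_slice_sq_le k hC ζ F)
      _ = C * ‖ζ‖ ^ 2 := by
          rw [integral_const_mul, norm_sq_eq_integral,
            setIntegral_rect_swap (integrable_sq_prod ζ)]
  · rw [inner_lowerTrace, abs_neg]
    -- Cutting the integrand on the null edge `s = c` gives a test function that vanishes for `s ≤
    -- c`, as `integral_shift_mul` requires.
    have h1 : ∫ p in rect a b c d, shift t ζ p * k i p.1
        = ∫ p in rect a b c d, shift t ζ p * (if c < p.2 then k i p.1 else 0) := by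
      refine integral_congr_ae ?_
      filter_upwards [ae_restrict_mem (measurableSet_rect a b c d), ae_rect_snd_ne a b c d c]
        with p hp hpc
      rw [if_pos (lt_of_le_of_ne hp.2.1 (Ne.symm hpc))]
    rw [h1, integral_shift_mul (ψ := fun p => if c < p.2 then k i p.1 else 0) ht ζ
      (fun x _ s hs => if_neg (not_lt.2 hs))]
    have h2 : ∀ p : ℝ × ℝ, ζ p * (if c < p.2 - t then k i p.1 else 0)
        = {p : ℝ × ℝ | c < p.2 - t}.indicator (fun p => ζ p * k i p.1) p := by
      intro p
      by_cases h : c < p.2 - t <;> simp [h]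
    have hms : MeasurableSet {p : ℝ × ℝ | c < p.2 - t} :=
      measurableSet_lt measurable_const (measurable_snd.sub_const t)
    simp only [h2]
    rw [setIntegral_rect_swap ((integrable_mul_fst ζ (k i)).indicator hms)]
    refine (abs_integral_le_integral_abs).trans (integral_mono
      ((integrable_mul_fst ζ (k i)).indicator hms).integral_prod_right.abs
      (integrable_mul_fst ζ (k i)).integral_prod_right.abs fun s => ?_)
    by_cases h : c < s - t
    · simp [h]
    · simp [h]

/-! ### Diagonal evolution equations in a Hilbert space -/

section Diagonal

variable {H : Type*} [NormedAddCommGroup H] [InnerProductSpace ℝ H] {ι : Type*}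

theorem norm_sq_eq_tsum (e : HilbertBasis ι ℝ H) (v : H) :
    ‖v‖ ^ 2 = ∑' i, inner ℝ (e i) v ^ 2 := by
  rw [← real_inner_self_eq_norm_sq, ← e.tsum_inner_mul_inner v v]
  refine tsum_congr fun i => ?_
  rw [real_inner_comm (e i) v, sq]

theorem sum_inner_sq_le (e : HilbertBasis ι ℝ H) (v : H) (F : Finset ι) :
    ∑ i ∈ F, inner ℝ (e i) v ^ 2 ≤ ‖v‖ ^ 2 := by
  simpa using e.orthonormal.sum_inner_products_le v (s := F)

/-- Riesz–Fischer, with the norm bound given by Parseval. -/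
theorem exists_of_coeff (e : HilbertBasis ι ℝ H) (y : ι → ℝ) {N : ℝ}
    (hN : ∀ F : Finset ι, ∑ i ∈ F, y i ^ 2 ≤ N) :
    ∃ v : H, (∀ i, inner ℝ (e i) v = y i) ∧ ‖v‖ ^ 2 ≤ N := by
  have hs : Summable fun i => y i ^ 2 :=
    summable_of_sum_le (fun i => sq_nonneg _) hN
  have hm : Memℓp y 2 := memℓp_gen (by simpa using hs)
  have hc : ∀ i, inner ℝ (e i) (e.repr.symm ⟨y, hm⟩) = y i := fun i => by
    rw [← e.repr_apply_apply]; simp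
  refine ⟨_, hc, ?_⟩
  rw [norm_sq_eq_tsum e]
  simp only [hc]
  exact Real.tsum_le_of_sum_le (fun i => sq_nonneg _) hN

/-- Dominated convergence in the Parseval series of `w t - w t₀`, with the summable majorant `4
Eᵢ²`. -/
theorem continuous_of_coeff (e : HilbertBasis ι ℝ H) {w : ℝ → H}
    (hw : ∀ i, Continuous fun t => inner ℝ (e i) (w t)) {E : ι → ℝ} {N : ℝ}
    (hN : ∀ F : Finset ι, ∑ i ∈ F, E i ^ 2 ≤ N) (hE : ∀ t i, |inner ℝ (e i) (w t)| ≤ E i) :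
    Continuous w := by
  rw [continuous_iff_continuousAt]
  intro t₀
  have hs : Summable fun i => 4 * E i ^ 2 :=
    (summable_of_sum_le (fun i => sq_nonneg _) hN).mul_left 4
  have h1 : Tendsto (fun t => ∑' i, inner ℝ (e i) (w t - w t₀) ^ 2) (𝓝 t₀)
      (𝓝 (∑' _ : ι, (0 : ℝ))) := by
    refine tendsto_tsum_of_dominated_convergence hs (fun i => ?_) (.of_forall fun t i => ?_)
    · have : Continuous fun t => inner ℝ (e i) (w t - w t₀) ^ 2 := by
        simp only [inner_sub_right]
        exact ((hw i).sub continuous_const).pow 2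
      simpa using this.tendsto t₀
    · rw [Real.norm_eq_abs, abs_of_nonneg (sq_nonneg _), inner_sub_right]
      have a1 := abs_le.1 (hE t i)
      have a2 := abs_le.1 (hE t₀ i)
      have := sq_le_sq' (a := inner ℝ (e i) (w t) - inner ℝ (e i) (w t₀)) (b := 2 * E i)
        (by linarith) (by linarith)
      linarith
  simp only [← norm_sq_eq_tsum, tsum_zero] at h1
  rw [ContinuousAt, tendsto_iff_norm_sub_tendsto_zero]
  have h2 := h1.sqrt
  simpa [Real.sqrt_sq] using h2

/-- The solution of `y' = -μ (y - f)`, `y 0 = y₀`. -/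
def relax (μ y₀ : ℝ) (f : ℝ → ℝ) (t : ℝ) : ℝ :=
  Real.exp (-μ * t) * (y₀ + ∫ s in (0 : ℝ)..t, μ * Real.exp (μ * s) * f s)

theorem relax_zero (μ y₀ : ℝ) (f : ℝ → ℝ) : relax μ y₀ f 0 = y₀ := by simp [relax]

theorem hasDerivAt_relax (μ y₀ : ℝ) {f : ℝ → ℝ} (hf : Continuous f) (t : ℝ) :
    HasDerivAt (relax μ y₀ f) (-μ * (relax μ y₀ f t - f t)) t := by
  have hc : Continuous fun s => μ * Real.exp (μ * s) * f s := by fun_prop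
  have h1 : HasDerivAt (fun t => ∫ s in (0 : ℝ)..t, μ * Real.exp (μ * s) * f s)
      (μ * Real.exp (μ * t) * f t) t :=
    intervalIntegral.integral_hasDerivAt_right (hc.intervalIntegrable _ _)
      hc.aestronglyMeasurable.stronglyMeasurableAtFilter hc.continuousAt
  have h2 : HasDerivAt (fun t => Real.exp (-μ * t)) (Real.exp (-μ * t) * (-μ)) t := by
    simpa using ((hasDerivAt_id t).const_mul (-μ)).exp
  have h3 := h2.mul (h1.const_add y₀)
  have h4 : Real.exp (-μ * t) * Real.exp (μ * t) = 1 := by rw [← Real.exp_add]; simp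
  refine h3.congr_deriv ?_
  rw [relax]
  linear_combination μ * f t * h4

/-- The weight `μ e^{μs}` has total mass `e^{μt} - 1`, so the bound loses no power of `μ`. This
makes it uniform over the unbounded spectrum. -/
theorem abs_integral_relax_le {μ A : ℝ} (hμ : 0 ≤ μ) {f : ℝ → ℝ}
    (hA : ∀ s, 0 ≤ s → |f s| ≤ A) {t : ℝ} (ht : 0 ≤ t) :
    |∫ s in (0 : ℝ)..t, μ * Real.exp (μ * s) * f s| ≤ A * (Real.exp (μ * t) - 1) := by
  have h1 : ∫ s in (0 : ℝ)..t, μ * Real.exp (μ * s) * A = A * (Real.exp (μ * t) - 1) := by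
    rw [intervalIntegral.integral_eq_sub_of_hasDerivAt (f := fun s => A * Real.exp (μ * s))]
    · simp; ring
    · intro s _
      have := (((hasDerivAt_id s).const_mul μ).exp).const_mul A
      refine this.congr_deriv ?_
      simp; ring
    · exact Continuous.intervalIntegrable (by fun_prop) _ _
  rw [← h1, ← Real.norm_eq_abs]
  refine intervalIntegral.norm_integral_le_of_norm_le ht (.of_forall fun s hs => ?_)
    (Continuous.intervalIntegrable (by fun_prop) _ _)
  rw [Real.norm_eq_abs, abs_mul, abs_of_nonneg (by positivity)]
  gcongr
  exact hA s hs.1.le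

/-- The forcing acts only up to `min t τ`; from then on the solution decays freely at a rate `μ ≥
κ`. -/
theorem abs_relax_le {μ κ A τ : ℝ} (hκ : 0 ≤ κ) (hμ : κ ≤ μ) (y₀ : ℝ) {f : ℝ → ℝ}
    (hf : Continuous f) (hA0 : 0 ≤ A) (hA : ∀ s, 0 ≤ s → |f s| ≤ A) (hτ : 0 ≤ τ)
    (hz : ∀ s, τ ≤ s → f s = 0) {t : ℝ} (ht : 0 ≤ t) :
    |relax μ y₀ f t| ≤ Real.exp (κ * (τ - t)) * (|y₀| + A) := by
  have hμ0 : 0 ≤ μ := hκ.trans hμ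
  have hexp : 1 ≤ Real.exp (μ * min t τ) := Real.one_le_exp (by positivity)
  have hsplit : ∫ s in (0 : ℝ)..t, μ * Real.exp (μ * s) * f s
      = ∫ s in (0 : ℝ)..(min t τ), μ * Real.exp (μ * s) * f s := by
    rcases le_total t τ with h | h
    · rw [min_eq_left h]
    · rw [min_eq_right h, ← intervalIntegral.integral_add_adjacent_intervals (b := τ)
        (Continuous.intervalIntegrable (by fun_prop) _ _)
        (Continuous.intervalIntegrable (by fun_prop) _ _)]
      rw [intervalIntegral.integral_congr (a := τ) (b := t) (g := fun _ => 0)]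
      · simp
      · intro s hs
        rw [uIcc_of_le h] at hs
        simp [hz s hs.1]
  have h1 := abs_integral_relax_le hμ0 hA (t := min t τ) (le_min ht hτ)
  rw [relax, hsplit, abs_mul, abs_of_pos (Real.exp_pos _)]
  have h2 : |y₀ + ∫ s in (0 : ℝ)..(min t τ), μ * Real.exp (μ * s) * f s|
      ≤ Real.exp (μ * min t τ) * (|y₀| + A) := by
    refine (abs_add_le _ _).trans ?_
    have := abs_nonneg y₀
    nlinarith
  calc _ ≤ Real.exp (-μ * t) * (Real.exp (μ * min t τ) * (|y₀| + A)) := by gcongr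
    _ = Real.exp (μ * (min t τ - t)) * (|y₀| + A) := by
        rw [← mul_assoc, ← Real.exp_add]; ring_nf
    _ ≤ Real.exp (κ * (τ - t)) * (|y₀| + A) := by
        -- The factor `min t τ - t` is nonpositive, so lowering the rate from `μ` to `κ` increases
        -- the exponent.
        refine mul_le_mul_of_nonneg_right (Real.exp_le_exp.2 ?_) (by positivity)
        have a1 : min t τ - t ≤ 0 := by linarith [min_le_left t τ]
        calc μ * (min t τ - t) ≤ κ * (min t τ - t) := mul_le_mul_of_nonpos_right hμ a1
          _ ≤ κ * (τ - t) := by gcongr; exact min_le_right t τ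

/-- Solvability of `w' = -Λ (w - h)`, tested against the domain of the diagonal operator `Λ`, when
the coefficients of `h` are square summable uniformly in time. -/
theorem exists_diagonal_solution [CompleteSpace H] (e : HilbertBasis ι ℝ H) {Λ : ι → ℝ} {κ : ℝ} (hκ : 0 ≤ κ)
    (hΛ : ∀ i, κ ≤ Λ i) {h : ℝ → H} (hc : Continuous h) {A : ι → ℝ} (hA0 : ∀ i, 0 ≤ A i) {M : ℝ}
    (hM : ∀ F : Finset ι, ∑ i ∈ F, A i ^ 2 ≤ M) (hA : ∀ t, 0 ≤ t → ∀ i, |inner ℝ (e i) (h t)| ≤ A i)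
    {τ : ℝ} (hτ : 0 ≤ τ) (hz : ∀ t, τ ≤ t → h t = 0) (w₀ : H) :
    ∃ w : ℝ → H, Continuous w ∧ w 0 = w₀ ∧
      (∀ t, 0 ≤ t → ‖w t‖ ^ 2 ≤ Real.exp (2 * κ * (τ - t)) * (2 * (‖w₀‖ ^ 2 + M))) ∧
      ∀ φ ψ : H, (∀ i, inner ℝ (e i) ψ = -Λ i * inner ℝ (e i) φ) → ∀ t ∈ Ici (0 : ℝ),
        HasDerivWithinAt (fun r => inner ℝ φ (w r)) (inner ℝ ψ (w t - h t)) (Ici 0) t := by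
  set f : ι → ℝ → ℝ := fun i t => inner ℝ (e i) (h t) with hf
  have hfc : ∀ i, Continuous (f i) := fun i => continuous_const.inner hc
  set y : ι → ℝ → ℝ := fun i t => relax (Λ i) (inner ℝ (e i) w₀) (f i) t with hy
  have hyd : ∀ i t, HasDerivAt (y i) (-Λ i * (y i t - f i t)) t := fun i t =>
    hasDerivAt_relax _ _ (hfc i) t
  have hyb : ∀ t, 0 ≤ t → ∀ i, |y i t| ≤ Real.exp (κ * (τ - t)) * (|inner ℝ (e i) w₀| + A i) :=
    fun t ht i => abs_relax_le hκ (hΛ i) _ (hfc i) (hA0 i) (fun s hs => hA s hs i) hτ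
      (fun s hs => by simp [hf, hz s hs]) ht
  have hE : ∀ F : Finset ι, ∑ i ∈ F, (|inner ℝ (e i) w₀| + A i) ^ 2 ≤ 2 * (‖w₀‖ ^ 2 + M) := by
    intro F
    have h1 := sum_inner_sq_le e w₀ F
    have h2 := hM F
    calc _ ≤ ∑ i ∈ F, (2 * inner ℝ (e i) w₀ ^ 2 + 2 * A i ^ 2) := by
          refine Finset.sum_le_sum fun i _ => ?_
          rw [← sq_abs (inner ℝ (e i) w₀)]
          nlinarith [sq_nonneg (|inner ℝ (e i) w₀| - A i)]
      _ ≤ _ := by rw [Finset.sum_add_distrib, ← Finset.mul_sum, ← Finset.mul_sum]; linarith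
  have hsum : ∀ (c : ℝ) (F : Finset ι), ∑ i ∈ F, (c * (|inner ℝ (e i) w₀| + A i)) ^ 2
      ≤ c ^ 2 * (2 * (‖w₀‖ ^ 2 + M)) := by
    intro c F
    simp only [mul_pow]
    rw [← Finset.mul_sum]
    exact mul_le_mul_of_nonneg_left (hE F) (sq_nonneg c)
  -- The coefficients are assembled into a vector at each time, with negative times frozen at `0`
  -- since the bounds on `h` hold for `t ≥ 0` only.
  have hex : ∀ t : ℝ, ∃ v : H, (∀ i, inner ℝ (e i) v = y i (max t 0)) ∧
      ‖v‖ ^ 2 ≤ Real.exp (κ * (τ - max t 0)) ^ 2 * (2 * (‖w₀‖ ^ 2 + M)) := by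
    intro t
    refine exists_of_coeff e _ fun F => (Finset.sum_le_sum fun i _ => ?_).trans (hsum _ F)
    rw [← sq_abs]
    exact pow_le_pow_left₀ (abs_nonneg _) (hyb _ (le_max_right t 0) i) 2
  choose w hwc hwn using hex
  have hcont : Continuous w := by
    refine continuous_of_coeff e (fun i => ?_) (hsum (Real.exp (κ * τ))) fun t i => ?_
    · simp only [hwc]
      have h1 : Continuous (y i) := continuous_iff_continuousAt.2 fun t => (hyd i t).continuousAt
      exact h1.comp (continuous_id.max continuous_const)
    · rw [hwc]
      refine (hyb _ (le_max_right t 0) i).trans ?_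
      have h2 := hA0 i
      have h3 : κ * (τ - max t 0) ≤ κ * τ :=
        mul_le_mul_of_nonneg_left (by linarith [le_max_right t 0]) hκ
      gcongr
  have hext : ∀ u v : H, (∀ i, inner ℝ (e i) u = inner ℝ (e i) v) → u = v := by
    intro u v huv
    rw [← sub_eq_zero, ← norm_eq_zero, ← sq_eq_zero_iff, norm_sq_eq_tsum e]
    simp [inner_sub_right, huv]
  refine ⟨w, hcont, hext _ _ fun i => ?_, fun t ht => ?_, fun φ ψ hφψ t ht => ?_⟩
  · rw [hwc, max_self]; exact relax_zero _ _ _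
  · have := hwn t
    rw [max_eq_left ht, ← Real.exp_nat_mul] at this
    refine this.trans (le_of_eq ?_)
    congr 2
    push_cast; ring
  · have hd : Continuous fun t => w t - h t := hcont.sub hc
    have hI : HasDerivAt (fun t => ∫ s in (0 : ℝ)..t, (w s - h s)) (w t - h t) t :=
      intervalIntegral.integral_hasDerivAt_right (hd.intervalIntegrable _ _)
        hd.aestronglyMeasurable.stronglyMeasurableAtFilter hd.continuousAt
    -- The integrated identity is compared term by term in two Parseval series. The unbounded factor
    -- `Λ i` is carried by `ψ`, so `w` need not lie in the domain of `Λ` and no series is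
    -- differentiated.
    have key : ∀ r ∈ Ici (0 : ℝ), inner ℝ φ (w r)
        = inner ℝ φ (w 0) + inner ℝ ψ (∫ s in (0 : ℝ)..r, (w s - h s)) := by
      intro r hr
      have hr : 0 ≤ r := hr
      rw [← sub_eq_iff_eq_add', ← inner_sub_right, ← e.tsum_inner_mul_inner,
        ← e.tsum_inner_mul_inner ψ]
      refine tsum_congr fun i => ?_
      have h1 : inner ℝ (e i) (∫ s in (0 : ℝ)..r, (w s - h s))
          = ∫ s in (0 : ℝ)..r, inner ℝ (e i) (w s - h s) :=
        ((innerSL ℝ (e i)).intervalIntegral_comp_comm (hd.intervalIntegrable _ _)).symm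
      have h2 : inner ℝ (e i) (w r - w 0) = -Λ i * ∫ s in (0 : ℝ)..r, inner ℝ (e i) (w s - h s) := by
        rw [inner_sub_right, hwc, hwc, max_self, max_eq_left hr,
          ← intervalIntegral.integral_const_mul]
        rw [← intervalIntegral.integral_eq_sub_of_hasDerivAt (fun s _ => hyd i s)]
        · refine intervalIntegral.integral_congr fun s hs => ?_
          rw [uIcc_of_le hr] at hs
          simp only [inner_sub_right, hwc, max_eq_left hs.1]
          rfl
        · have h1 : Continuous (y i) :=
            continuous_iff_continuousAt.2 fun t => (hyd i t).continuousAt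
          have := hfc i
          exact Continuous.intervalIntegrable (by fun_prop) _ _
      rw [h2, h1, real_inner_comm (e i) ψ, hφψ, real_inner_comm (e i) φ]
      ring
    have hD : HasDerivWithinAt
        (fun r => inner ℝ φ (w 0) + inner ℝ ψ (∫ s in (0 : ℝ)..r, (w s - h s)))
        (inner ℝ ψ (w t - h t)) (Ici 0) t :=
      (((innerSL ℝ ψ).hasFDerivAt.comp_hasDerivAt t hI).const_add _).hasDerivWithinAt
    exact hD.congr key (key t ht)

end Diagonal

/-! ### The sine basis of a rectangle -/

/-- The affine map sending `[a, b]` onto `[0, π]`. -/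
def angle (a b x : ℝ) : ℝ := Real.pi / (b - a) * (x - a)

theorem contDiff_angle (a b : ℝ) : ContDiff ℝ ∞ (angle a b) :=
  contDiff_const.mul (contDiff_id.sub contDiff_const)

theorem hasDerivAt_angle (a b x : ℝ) : HasDerivAt (angle a b) (Real.pi / (b - a)) x := by
  have h := ((hasDerivAt_id x).sub_const a).const_mul (Real.pi / (b - a))
  rw [mul_one] at h
  exact h

theorem angle_left (a b : ℝ) : angle a b a = 0 := by simp [angle]

theorem angle_right (hab : a < b) : angle a b b = Real.pi :=
  div_mul_cancel₀ _ (sub_pos.2 hab).ne'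

theorem angle_mem_Icc (hab : a < b) {x : ℝ} (hx : x ∈ Icc a b) : angle a b x ∈ Icc 0 Real.pi := by
  have h : 0 < b - a := sub_pos.2 hab
  constructor
  · have := hx.1
    have : 0 ≤ x - a := by linarith
    have := Real.pi_pos
    unfold angle; positivity
  · calc Real.pi / (b - a) * (x - a) ≤ Real.pi / (b - a) * (b - a) := by
          have := Real.pi_pos
          gcongr; exact hx.2
      _ = Real.pi := div_mul_cancel₀ _ h.ne'

theorem angle_mem_Ioo (hab : a < b) {x : ℝ} (hx : x ∈ Ioo a b) : angle a b x ∈ Ioo 0 Real.pi := by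
  have h : 0 < b - a := sub_pos.2 hab
  have hpi := Real.pi_pos
  constructor
  · have := hx.1
    have : 0 < x - a := by linarith
    unfold angle; positivity
  · calc Real.pi / (b - a) * (x - a) < Real.pi / (b - a) * (b - a) := by
          gcongr; exact hx.2
      _ = Real.pi := div_mul_cancel₀ _ h.ne'

theorem injective_angle (hab : a < b) : Function.Injective (angle a b) := by
  intro x y h
  have h1 : Real.pi / (b - a) ≠ 0 := (div_pos Real.pi_pos (sub_pos.2 hab)).ne'
  simpa [angle, h1, (sub_pos.2 hab).ne'] using h

theorem integral_cos_angle (hab : a < b) {j : ℤ} (hj : j ≠ 0) :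
    ∫ x in a..b, Real.cos (j * angle a b x) = 0 := by
  have hω : (j : ℝ) * (Real.pi / (b - a)) ≠ 0 :=
    mul_ne_zero (by exact_mod_cast hj) (div_pos Real.pi_pos (sub_pos.2 hab)).ne'
  rw [intervalIntegral.integral_eq_sub_of_hasDerivAt
    (f := fun x => Real.sin (j * angle a b x) / (j * (Real.pi / (b - a))))]
  · rw [angle_left, angle_right hab, Real.sin_int_mul_pi]; simp
  · intro x _
    have := (((hasDerivAt_angle a b x).const_mul (j : ℝ)).sin).div_const
      (j * (Real.pi / (b - a)))
    exact this.congr_deriv (mul_div_cancel_right₀ _ hω)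
  · have := (contDiff_angle a b).continuous
    exact Continuous.intervalIntegrable (by fun_prop) _ _

/-- The Dirichlet eigenfunctions of an interval. -/
def sineMode (a b : ℝ) (m : ℕ) (x : ℝ) : ℝ := Real.sin (((m : ℤ) + 1 : ℤ) * angle a b x)

theorem contDiff_sineMode (a b : ℝ) (m : ℕ) : ContDiff ℝ ∞ (sineMode a b m) :=
  Real.contDiff_sin.comp (contDiff_const.mul (contDiff_angle a b))

theorem sineMode_left (a b : ℝ) (m : ℕ) : sineMode a b m a = 0 := by
  simp [sineMode, angle_left]

theorem sineMode_right (hab : a < b) (m : ℕ) : sineMode a b m b = 0 := by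
  rw [sineMode, angle_right hab, Real.sin_int_mul_pi]

theorem integral_sineMode_mul (hab : a < b) (m n : ℕ) :
    ∫ x in Icc a b, sineMode a b m x * sineMode a b n x = if m = n then (b - a) / 2 else 0 := by
  rw [integral_Icc_eq_integral_Ioc, ← intervalIntegral.integral_of_le hab.le]
  have h : ∀ x, sineMode a b m x * sineMode a b n x
      = (1 / 2) * (Real.cos (((m : ℤ) - n : ℤ) * angle a b x)
        - Real.cos (((m : ℤ) + n + 2 : ℤ) * angle a b x)) := by
    intro x
    rw [Real.cos_sub_cos, sineMode, sineMode]
    rw [show ((((m : ℤ) - n : ℤ) : ℝ) * angle a b x + (((m : ℤ) + n + 2 : ℤ) : ℝ) * angle a b x) / 2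
      = (((m : ℤ) + 1 : ℤ) : ℝ) * angle a b x by push_cast; ring,
      show ((((m : ℤ) - n : ℤ) : ℝ) * angle a b x - (((m : ℤ) + n + 2 : ℤ) : ℝ) * angle a b x) / 2
      = -((((n : ℤ) + 1 : ℤ) : ℝ) * angle a b x) by push_cast; ring, Real.sin_neg]
    ring
  have hc := (contDiff_angle a b).continuous
  simp only [h]
  rw [intervalIntegral.integral_const_mul, intervalIntegral.integral_sub
    (Continuous.intervalIntegrable (by fun_prop) _ _)
    (Continuous.intervalIntegrable (by fun_prop) _ _),
    integral_cos_angle hab (j := (m : ℤ) + n + 2) (by positivity)]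
  split_ifs with hmn
  · subst hmn
    simp; ring
  · rw [integral_cos_angle hab (by simpa [sub_eq_zero] using hmn)]
    simp

/-- The normalized Dirichlet eigenfunctions of a rectangle. -/
def sineFun (a b c d : ℝ) (n : ℕ × ℕ) (p : ℝ × ℝ) : ℝ :=
  Real.sqrt ((b - a) / 2 * ((d - c) / 2))⁻¹ * (sineMode a b n.1 p.1 * sineMode c d n.2 p.2)

theorem contDiff_sineFun (a b c d : ℝ) (n : ℕ × ℕ) : ContDiff ℝ ∞ (sineFun a b c d n) :=
  contDiff_const.mul (((contDiff_sineMode a b n.1).comp contDiff_fst).mul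
    ((contDiff_sineMode c d n.2).comp contDiff_snd))

/-- The normalized Dirichlet eigenfunctions of a rectangle, as elements of `L²`. -/
def sineVec (a b c d : ℝ) (n : ℕ × ℕ) : L2Rect a b c d :=
  (memLp_rect (contDiff_sineFun a b c d n).continuous).toLp _

theorem inner_sineVec (n : ℕ × ℕ) (u : L2Rect a b c d) :
    inner ℝ (sineVec a b c d n) u = ∫ p in rect a b c d, u p * sineFun a b c d n p :=
  (setIntegral_rect_mul_eq_inner u (contDiff_sineFun a b c d n).continuous).symm

theorem orthonormal_sineVec (hab : a < b) (hcd : c < d) : Orthonormal ℝ (sineVec a b c d) := by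
  have h1 : 0 < (b - a) / 2 * ((d - c) / 2) := by
    have := sub_pos.2 hab; have := sub_pos.2 hcd; positivity
  rw [orthonormal_iff_ite]
  intro m n
  rw [inner_sineVec]
  have h2 : ∫ p in rect a b c d, sineVec a b c d n p * sineFun a b c d m p
      = ∫ p in rect a b c d, ((b - a) / 2 * ((d - c) / 2))⁻¹ *
        ((sineMode a b m.1 p.1 * sineMode a b n.1 p.1) *
          (sineMode c d m.2 p.2 * sineMode c d n.2 p.2)) := by
    refine integral_congr_ae ?_
    filter_upwards [(memLp_rect (a := a) (b := b) (c := c) (d := d)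
      (contDiff_sineFun a b c d n).continuous).coeFn_toLp] with p hp
    rw [sineVec, hp, sineFun, sineFun]
    have h3 := Real.mul_self_sqrt (inv_nonneg.2 h1.le)
    linear_combination (sineMode a b m.1 p.1 * sineMode a b n.1 p.1 *
          (sineMode c d m.2 p.2 * sineMode c d n.2 p.2)) * h3
  rw [h2, integral_const_mul, rect, Measure.volume_eq_prod,
    setIntegral_prod_mul (fun x => sineMode a b m.1 x * sineMode a b n.1 x)
      (fun y => sineMode c d m.2 y * sineMode c d n.2 y),
    integral_sineMode_mul hab, integral_sineMode_mul hcd]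
  by_cases hmn : m = n
  · subst hmn
    simp only [if_true]
    exact inv_mul_cancel₀ h1.ne'
  · rw [if_neg hmn]
    by_cases h3 : m.1 = n.1
    · have h4 : m.2 ≠ n.2 := fun h4 => hmn (Prod.ext h3 h4)
      simp [h4]
    · simp [h3]

/-- Products of cosines on a rectangle. -/
def cosProd (a b c d : ℝ) (m : ℤ × ℤ) : C(rect a b c d, ℝ) where
  toFun p := Real.cos (m.1 * angle a b p.1.1) * Real.cos (m.2 * angle c d p.1.2)
  continuous_toFun := by
    have := (contDiff_angle a b).continuous
    have := (contDiff_angle c d).continuous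
    fun_prop

theorem cosProd_mul (m n : ℤ × ℤ) : cosProd a b c d m * cosProd a b c d n
    = (1 / 4 : ℝ) • (cosProd a b c d (m.1 + n.1, m.2 + n.2) + cosProd a b c d (m.1 + n.1, m.2 - n.2)
      + cosProd a b c d (m.1 - n.1, m.2 + n.2) + cosProd a b c d (m.1 - n.1, m.2 - n.2)) := by
  ext p
  simp only [cosProd, ContinuousMap.mul_apply, ContinuousMap.coe_mk, ContinuousMap.smul_apply,
    ContinuousMap.add_apply, smul_eq_mul]
  push_cast
  simp only [add_mul, sub_mul, Real.cos_add, Real.cos_sub]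
  ring

/-- The algebra of cosine polynomials on a rectangle. -/
def cosAlg (a b c d : ℝ) : Subalgebra ℝ C(rect a b c d, ℝ) :=
  (Submodule.span ℝ (range (cosProd a b c d))).toSubalgebra
    (Submodule.subset_span ⟨0, by ext; simp [cosProd]⟩) (fun f g hf hg => by
      induction hf, hg using Submodule.span_induction₂ with
      | mem_mem x y hx hy =>
        obtain ⟨m, rfl⟩ := hx
        obtain ⟨n, rfl⟩ := hy
        rw [cosProd_mul]
        refine Submodule.smul_mem _ _ (Submodule.add_mem _ (Submodule.add_mem _
          (Submodule.add_mem _ ?_ ?_) ?_) ?_) <;> exact Submodule.subset_span (mem_range_self _)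
      | zero_left y hy => simp
      | zero_right x hx => simp
      | add_left x y z hx hy hz h1 h2 => rw [add_mul]; exact Submodule.add_mem _ h1 h2
      | add_right x y z hx hy hz h1 h2 => rw [mul_add]; exact Submodule.add_mem _ h1 h2
      | smul_left r x y hx hy h => rw [smul_mul_assoc]; exact Submodule.smul_mem _ _ h
      | smul_right r x y hx hy h => rw [mul_smul_comm]; exact Submodule.smul_mem _ _ h)

/-- Cosine is injective on `[0, π]`, whereas sines all vanish on the boundary. This is why
completeness of the sines is derived from cosine polynomials. -/
theorem cosAlg_separatesPoints (hab : a < b) (hcd : c < d) :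
    (cosAlg a b c d).SeparatesPoints := by
  have hmem : ∀ m, cosProd a b c d m ∈ cosAlg a b c d := fun m =>
    Submodule.subset_span (mem_range_self m)
  intro p q hpq
  by_cases h1 : p.1.1 = q.1.1
  · refine ⟨_, ⟨_, hmem (0, 1), rfl⟩, fun h => hpq ?_⟩
    simp only [cosProd, ContinuousMap.coe_mk, Int.cast_zero, zero_mul, Real.cos_zero, one_mul,
      Int.cast_one] at h
    have h2 := injective_angle hcd (Real.injOn_cos (angle_mem_Icc hcd p.2.2)
      (angle_mem_Icc hcd q.2.2) h)
    exact Subtype.ext (Prod.ext h1 h2)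
  · refine ⟨_, ⟨_, hmem (1, 0), rfl⟩, fun h => h1 ?_⟩
    simp only [cosProd, ContinuousMap.coe_mk, Int.cast_zero, zero_mul, Real.cos_zero, mul_one,
      Int.cast_one, one_mul] at h
    exact injective_angle hab (Real.injOn_cos (angle_mem_Icc hab p.2.1)
      (angle_mem_Icc hab q.2.1) h)

/-- A function orthogonal to all products of cosines vanishes. -/
theorem ae_eq_zero_of_forall_cosProd (hab : a < b) (hcd : c < d) {v : ℝ × ℝ → ℝ}
    (hv : Integrable v (volume.restrict (rect a b c d)))
    (h : ∀ m n : ℤ, ∫ p in rect a b c d,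
      v p * (Real.cos (m * angle a b p.1) * Real.cos (n * angle c d p.2)) = 0) :
    v =ᵐ[volume.restrict (rect a b c d)] 0 := by
  have hint : ∀ G : ℝ × ℝ → ℝ, Continuous G →
      Integrable (fun p => v p * G p) (volume.restrict (rect a b c d)) := fun G hG =>
    IntegrableOn.mul_continuousOn hv hG.continuousOn (isCompact_rect a b c d)
  -- Members of the algebra live on the compact subtype. The induction carries a continuous
  -- representative on the plane, for which the integral makes sense.
  have hcos : ∀ g ∈ cosAlg a b c d, ∃ G : ℝ × ℝ → ℝ, Continuous G ∧
      (∀ p : rect a b c d, G p = g p) ∧ ∫ p in rect a b c d, v p * G p = 0 := by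
    intro g hg
    replace hg : g ∈ Submodule.span ℝ (range (cosProd a b c d)) := hg
    induction hg using Submodule.span_induction with
    | mem x hx =>
      obtain ⟨m, rfl⟩ := hx
      refine ⟨fun p => Real.cos (m.1 * angle a b p.1) * Real.cos (m.2 * angle c d p.2), ?_,
        fun p => rfl, h m.1 m.2⟩
      have := (contDiff_angle a b).continuous
      have := (contDiff_angle c d).continuous
      fun_prop
    | zero => exact ⟨0, continuous_zero, fun p => rfl, by simp⟩
    | add x y _ _ h1 h2 =>
      obtain ⟨G, g1, g2, g3⟩ := h1
      obtain ⟨G', g1', g2', g3'⟩ := h2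
      refine ⟨fun p => G p + G' p, g1.add g1', fun p => by simp [g2, g2'], ?_⟩
      simp only [mul_add]
      rw [integral_add (hint _ g1) (hint _ g1'), g3, g3', add_zero]
    | smul r x _ h1 =>
      obtain ⟨G, g1, g2, g3⟩ := h1
      refine ⟨fun p => r * G p, continuous_const.mul g1, fun p => by simp [g2], ?_⟩
      simp only [mul_left_comm _ r]
      rw [integral_const_mul, g3, mul_zero]
  refine ae_eq_zero_of_forall_test hv fun φ h1 _ _ => ?_
  have hφ := h1.continuous
  have : CompactSpace (rect a b c d) := isCompact_iff_compactSpace.1 (isCompact_rect a b c d)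
  rw [← abs_eq_zero]
  refine le_antisymm (le_of_forall_pos_le_add fun ε hε => ?_) (abs_nonneg _)
  -- Stone–Weierstrass approximates `φ` uniformly within `ε / (I + 1)`, so the error in the integral
  -- is at most `ε`; the `+ 1` covers the case `I = 0`.
  set I := ∫ p in rect a b c d, |v p|
  have hI : 0 ≤ I := integral_nonneg fun p => abs_nonneg _
  obtain ⟨⟨g, hg⟩, hgε⟩ :=
    ContinuousMap.exists_mem_subalgebra_near_continuous_of_separatesPoints (cosAlg a b c d)
    (cosAlg_separatesPoints hab hcd) (fun p => φ p) (hφ.comp continuous_subtype_val)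
    (ε / (I + 1)) (by positivity)
  obtain ⟨G, g1, g2, g3⟩ := hcos g hg
  rw [zero_add, ← sub_zero (∫ p in rect a b c d, v p * φ p), ← g3,
    ← integral_sub (hint _ hφ) (hint _ g1)]
  refine abs_integral_le_integral_abs.trans ?_
  calc _ ≤ ∫ p in rect a b c d, |v p| * (ε / (I + 1)) := by
        refine integral_mono_ae ((hint _ hφ).sub (hint _ g1)).abs (hv.abs.mul_const _) ?_
        filter_upwards [ae_restrict_mem (measurableSet_rect a b c d)] with p hp
        have := hgε ⟨p, hp⟩
        rw [← mul_sub, abs_mul, g2 ⟨p, hp⟩, abs_sub_comm]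
        gcongr
        exact this.le
    _ = I * (ε / (I + 1)) := integral_mul_const _ _
    _ ≤ ε := by
        rw [mul_div_assoc', div_le_iff₀ (by positivity)]
        nlinarith

/-- By `2 sin x cos mx = sin (m+1)x - sin (m-1)x`, a function `u` orthogonal to all sine products
makes `u` times the lowest mode orthogonal to all cosine products. That product is therefore zero
almost everywhere, and the lowest mode is positive in the interior. -/
theorem span_sineVec_orthogonal (hab : a < b) (hcd : c < d) :
    (Submodule.span ℝ (range (sineVec a b c d)))ᗮ = ⊥ := by
  rw [Submodule.eq_bot_iff]
  intro u hu
  have hN : Real.sqrt ((b - a) / 2 * ((d - c) / 2))⁻¹ ≠ 0 := by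
    have := sub_pos.2 hab; have := sub_pos.2 hcd; positivity
  have hca := (contDiff_angle a b).continuous
  have hcc := (contDiff_angle c d).continuous
  have hnat : ∀ m n : ℕ, ∫ p in rect a b c d,
      u p * (sineMode a b m p.1 * sineMode c d n p.2) = 0 := by
    intro m n
    have h1 := Submodule.inner_right_of_mem_orthogonal
      (Submodule.subset_span (mem_range_self (f := sineVec a b c d) (m, n))) hu
    rw [inner_sineVec] at h1
    simp only [sineFun, mul_left_comm _ (Real.sqrt _)] at h1
    rw [integral_const_mul] at h1
    exact (mul_eq_zero.1 h1).resolve_left hN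
  -- The frequencies `m - 1` may be zero or negative; oddness of the sine reduces them to positive
  -- ones.
  have hint : ∀ m n : ℤ, ∫ p in rect a b c d,
      u p * (Real.sin (m * angle a b p.1) * Real.sin (n * angle c d p.2)) = 0 := by
    have key : ∀ m : ℤ, m = 0 ∨ ∃ k : ℕ, m = (k : ℤ) + 1 ∨ m = -((k : ℤ) + 1) := by
      intro m
      rcases lt_trichotomy m 0 with h | h | h
      · exact Or.inr ⟨(-m - 1).toNat, Or.inr (by omega)⟩
      · exact Or.inl h
      · exact Or.inr ⟨(m - 1).toNat, Or.inl (by omega)⟩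
    intro m n
    rcases key m with rfl | ⟨k, hk⟩
    · simp
    rcases key n with rfl | ⟨j, hj⟩
    · simp
    have h1 := hnat k j
    simp only [sineMode] at h1
    rcases hk with rfl | rfl <;> rcases hj with rfl | rfl <;>
      simpa only [Int.cast_neg, neg_mul, Real.sin_neg, mul_neg, neg_neg, integral_neg,
        neg_eq_zero] using h1
  have hv : Integrable (fun p => u p * (Real.sin (angle a b p.1) * Real.sin (angle c d p.2)))
      (volume.restrict (rect a b c d)) :=
    integrable_mul u (by fun_prop)
  have hzero := ae_eq_zero_of_forall_cosProd hab hcd hv (fun m n => by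
    have hexp : ∀ p : ℝ × ℝ, u p * (Real.sin (angle a b p.1) * Real.sin (angle c d p.2)) *
        (Real.cos (m * angle a b p.1) * Real.cos (n * angle c d p.2))
        = (1 / 4) * (u p * (Real.sin ((m + 1 : ℤ) * angle a b p.1) *
            Real.sin ((n + 1 : ℤ) * angle c d p.2))
          - u p * (Real.sin ((m + 1 : ℤ) * angle a b p.1) *
            Real.sin ((n - 1 : ℤ) * angle c d p.2))
          - (u p * (Real.sin ((m - 1 : ℤ) * angle a b p.1) *
            Real.sin ((n + 1 : ℤ) * angle c d p.2))
          - u p * (Real.sin ((m - 1 : ℤ) * angle a b p.1) *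
            Real.sin ((n - 1 : ℤ) * angle c d p.2)))) := by
      intro p
      push_cast
      simp only [add_mul, sub_mul, one_mul, Real.sin_add, Real.sin_sub]
      ring
    have hi : ∀ m n : ℤ, Integrable (fun p : ℝ × ℝ =>
        u p * (Real.sin (m * angle a b p.1) * Real.sin (n * angle c d p.2)))
        (volume.restrict (rect a b c d)) := fun m n => integrable_mul u (by fun_prop)
    simp only [hexp]
    rw [integral_const_mul]
    refine mul_eq_zero_of_right _ ((integral_sub ((hi _ _).sub (hi _ _))
      ((hi _ _).sub (hi _ _))).trans ?_)
    rw [integral_sub' (hi _ _) (hi _ _), integral_sub' (hi _ _) (hi _ _)]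
    simp only [hint, sub_self])
  rw [Lp.eq_zero_iff_ae_eq_zero]
  have hmem : ∀ᵐ p ∂(volume.restrict (rect a b c d)), p ∈ Ioo a b ×ˢ Ioo c d := by
    rw [← ae_restrict_congr_set (rect_ae_eq_interior a b c d)]
    exact ae_restrict_mem (measurableSet_Ioo.prod measurableSet_Ioo)
  filter_upwards [hzero, hmem] with p hp hm
  have h1 := angle_mem_Ioo hab hm.1
  have h2 := angle_mem_Ioo hcd hm.2
  have h3 := Real.sin_pos_of_mem_Ioo h1
  have h4 := Real.sin_pos_of_mem_Ioo h2
  exact (mul_eq_zero.1 hp).resolve_right (mul_pos h3 h4).ne'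

/-- The Hilbert basis of Dirichlet eigenfunctions of a rectangle. -/
def sineBasis (hab : a < b) (hcd : c < d) : HilbertBasis (ℕ × ℕ) ℝ (L2Rect a b c d) :=
  HilbertBasis.mkOfOrthogonalEqBot (orthonormal_sineVec hab hcd) (span_sineVec_orthogonal hab hcd)

theorem sineBasis_apply (hab : a < b) (hcd : c < d) (n : ℕ × ℕ) :
    sineBasis hab hcd n = sineVec a b c d n := by
  rw [sineBasis, HilbertBasis.coe_mkOfOrthogonalEqBot]

/-- The Dirichlet eigenvalues of a rectangle. -/
def sineEig (a b c d : ℝ) (n : ℕ × ℕ) : ℝ :=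
  ((n.1 + 1) * (Real.pi / (b - a))) ^ 2 + ((n.2 + 1) * (Real.pi / (d - c))) ^ 2

theorem sineEig_ge (hab : a < b) (hcd : c < d) (n : ℕ × ℕ) :
    (Real.pi / (b - a)) ^ 2 + (Real.pi / (d - c)) ^ 2 ≤ sineEig a b c d n := by
  have h1 : 0 < Real.pi / (b - a) := div_pos Real.pi_pos (sub_pos.2 hab)
  have h2 : 0 < Real.pi / (d - c) := div_pos Real.pi_pos (sub_pos.2 hcd)
  have h3 : (0 : ℝ) ≤ n.1 := by positivity
  have h4 : (0 : ℝ) ≤ n.2 := by positivity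
  unfold sineEig
  gcongr <;> nlinarith

/-! ### Green's identities and the Laplacian on test functions -/

theorem contDiff_pd₁ {φ : ℝ × ℝ → ℝ} (hφ : ContDiff ℝ ∞ φ) : ContDiff ℝ ∞ (pd₁ φ) :=
  (hφ.fderiv_right (m := ∞) (by simp)).clm_apply contDiff_const

theorem contDiff_pd₂ {φ : ℝ × ℝ → ℝ} (hφ : ContDiff ℝ ∞ φ) : ContDiff ℝ ∞ (pd₂ φ) :=
  (hφ.fderiv_right (m := ∞) (by simp)).clm_apply contDiff_const

theorem contDiff_lap {φ : ℝ × ℝ → ℝ} (hφ : ContDiff ℝ ∞ φ) : ContDiff ℝ ∞ (lap φ) :=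
  (contDiff_pd₁ (contDiff_pd₁ hφ)).add (contDiff_pd₂ (contDiff_pd₂ hφ))

theorem pd₁_pd₂ {φ : ℝ × ℝ → ℝ} (hφ : ContDiff ℝ ∞ φ) (p : ℝ × ℝ) :
    pd₁ (pd₂ φ) p = pd₂ (pd₁ φ) p := by
  have h1 : DifferentiableAt ℝ (fderiv ℝ φ) p :=
    (hφ.fderiv_right (m := ∞) (by simp)).differentiable (by simp) p
  have h2 : ∀ v w : ℝ × ℝ, fderiv ℝ (fun q => fderiv ℝ φ q v) p w
      = fderiv ℝ (fderiv ℝ φ) p w v := fun v w => by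
    rw [fderiv_clm_apply h1 (differentiableAt_const v)]
    simp
  have h3 : IsSymmSndFDerivAt ℝ φ p := hφ.contDiffAt.isSymmSndFDerivAt
    (by rw [minSmoothness_of_isRCLikeNormedField]; exact (WithTop.coe_le_coe (b := (2 : ℕ∞))).2 le_top)
  change fderiv ℝ (fun q => fderiv ℝ φ q (0, 1)) p (1, 0)
    = fderiv ℝ (fun q => fderiv ℝ φ q (1, 0)) p (0, 1)
  rw [h2, h2]
  exact h3.eq _ _

theorem pd₁_mul {φ ψ : ℝ × ℝ → ℝ} (hφ : ContDiff ℝ ∞ φ) (hψ : ContDiff ℝ ∞ ψ) (p : ℝ × ℝ) :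
    pd₁ (fun p => φ p * ψ p) p = pd₁ φ p * ψ p + φ p * pd₁ ψ p :=
  pd₁_eq (x := p.1) (s := p.2) (differentiableAt_of_smooth (hφ.mul hψ) _)
    ((hasDerivAt_fst (x := p.1) (s := p.2) (differentiableAt_of_smooth hφ _)).mul
      (hasDerivAt_fst (x := p.1) (s := p.2) (differentiableAt_of_smooth hψ _)))

theorem pd₂_mul {φ ψ : ℝ × ℝ → ℝ} (hφ : ContDiff ℝ ∞ φ) (hψ : ContDiff ℝ ∞ ψ) (p : ℝ × ℝ) :
    pd₂ (fun p => φ p * ψ p) p = pd₂ φ p * ψ p + φ p * pd₂ ψ p :=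
  pd₂_eq (x := p.1) (s := p.2) (differentiableAt_of_smooth (hφ.mul hψ) _)
    ((hasDerivAt_snd (x := p.1) (s := p.2) (differentiableAt_of_smooth hφ _)).mul
      (hasDerivAt_snd (x := p.1) (s := p.2) (differentiableAt_of_smooth hψ _)))

/-- The divergence theorem on a rectangle. -/
theorem integral_divergence_rect (hab : a ≤ b) (hcd : c ≤ d) {F G : ℝ × ℝ → ℝ}
    (hF : ContDiff ℝ ∞ F) (hG : ContDiff ℝ ∞ G) :
    ∫ p in rect a b c d, (pd₁ F p + pd₂ G p)
      = ((∫ x in Icc a b, G (x, d)) - ∫ x in Icc a b, G (x, c))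
        + ((∫ y in Icc c d, F (b, y)) - ∫ y in Icc c d, F (a, y)) := by
  have h := integral_divergence_prod_Icc_of_hasFDerivAt_of_le F G (fderiv ℝ F) (fderiv ℝ G)
    (a, c) (b, d) ⟨hab, hcd⟩ hF.continuous.continuousOn hG.continuous.continuousOn
    (fun p _ => (differentiableAt_of_smooth hF p).hasFDerivAt)
    (fun p _ => (differentiableAt_of_smooth hG p).hasFDerivAt)
    (((continuous_pd₁ hF).add (continuous_pd₂ hG)).continuousOn.integrableOn_compact isCompact_Icc)
  simp only [intervalIntegral.integral_of_le hab, intervalIntegral.integral_of_le hcd,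
    ← integral_Icc_eq_integral_Ioc] at h
  rw [show rect a b c d = Icc (a, c) (b, d) from Icc_prod_Icc _ _ _ _]
  refine h.trans ?_
  ring

/-- Smooth functions vanishing on the boundary of a rectangle. -/
def dirichletTest (a b c d : ℝ) : Submodule ℝ (ℝ × ℝ → ℝ) where
  carrier := {φ | ContDiff ℝ ∞ φ ∧ ∀ p ∈ frontier (rect a b c d), φ p = 0}
  add_mem' := fun h1 h2 => ⟨h1.1.add h2.1, fun p hp => by simp [h1.2 p hp, h2.2 p hp]⟩
  zero_mem' := ⟨contDiff_const, fun p _ => rfl⟩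
  smul_mem' := fun r φ h => ⟨contDiff_const.smul h.1, fun p hp => by simp [h.2 p hp]⟩

theorem frontier_rect (hab : a < b) (hcd : c < d) :
    frontier (rect a b c d) = (Icc a b ×ˢ {c, d}) ∪ ({a, b} ×ˢ Icc c d) := by
  rw [rect, frontier_prod_eq, frontier_Icc hab.le, frontier_Icc hcd.le, closure_Icc, closure_Icc]

theorem mem_dirichletTest_iff (hab : a < b) (hcd : c < d) {φ : ℝ × ℝ → ℝ} :
    φ ∈ dirichletTest a b c d ↔ ContDiff ℝ ∞ φ ∧
      (∀ x ∈ Icc a b, φ (x, c) = 0 ∧ φ (x, d) = 0) ∧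
      ∀ y ∈ Icc c d, φ (a, y) = 0 ∧ φ (b, y) = 0 := by
  change (_ ∧ ∀ p ∈ frontier (rect a b c d), φ p = 0) ↔ _
  rw [frontier_rect hab hcd]
  refine and_congr_right fun _ => ⟨fun h => ⟨fun x hx => ⟨h _ (Or.inl ⟨hx, Or.inl rfl⟩),
    h _ (Or.inl ⟨hx, Or.inr rfl⟩)⟩, fun y hy => ⟨h _ (Or.inr ⟨Or.inl rfl, hy⟩),
    h _ (Or.inr ⟨Or.inr rfl, hy⟩)⟩⟩, ?_⟩
  rintro ⟨h1, h2⟩ ⟨x, y⟩ (⟨hx, hy⟩ | ⟨hx, hy⟩)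
  · rcases hy with hy | hy
    · rw [show y = c from hy]; exact (h1 x hx).1
    · rw [show y = d from hy]; exact (h1 x hx).2
  · rcases hx with hx | hx
    · rw [show x = a from hx]; exact (h2 y hy).1
    · rw [show x = b from hx]; exact (h2 y hy).2

/-- A closed interval determines the derivative at its end points too, so tangential derivatives of
a test function vanish on each edge up to the corners. -/
theorem deriv_eq_zero_of_eqOn_Icc {f : ℝ → ℝ} {f' x : ℝ} (hab : a < b)
    (hf : ∀ y ∈ Icc a b, f y = 0) (hx : x ∈ Icc a b) (h : HasDerivAt f f' x) : f' = 0 :=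
  (uniqueDiffOn_Icc hab x hx).eq_deriv _ h.hasDerivWithinAt
    ((hasDerivWithinAt_const x (Icc a b) (0 : ℝ)).congr hf (hf x hx))

/-- Green's first identity. -/
theorem integral_mul_lap (hab : a < b) (hcd : c < d) {φ η : ℝ × ℝ → ℝ} (hφ : ContDiff ℝ ∞ φ)
    (hη : η ∈ dirichletTest a b c d) :
    ∫ p in rect a b c d, η p * lap φ p
      = -∫ p in rect a b c d, (pd₁ η p * pd₁ φ p + pd₂ η p * pd₂ φ p) := by
  obtain ⟨h0, h1, h2⟩ := (mem_dirichletTest_iff hab hcd).1 hη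
  have h := integral_divergence_rect hab.le hcd.le (h0.mul (contDiff_pd₁ hφ))
    (h0.mul (contDiff_pd₂ hφ))
  have z1 : ∀ e, (∀ x ∈ Icc a b, η (x, e) = 0) →
      ∫ x in Icc a b, η (x, e) * pd₂ φ (x, e) = 0 := fun e he =>
    setIntegral_eq_zero_of_forall_eq_zero fun x hx => by rw [he x hx, zero_mul]
  have z2 : ∀ e, (∀ y ∈ Icc c d, η (e, y) = 0) →
      ∫ y in Icc c d, η (e, y) * pd₁ φ (e, y) = 0 := fun e he =>
    setIntegral_eq_zero_of_forall_eq_zero fun x hx => by rw [he x hx, zero_mul]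
  rw [z1 d fun x hx => (h1 x hx).2, z1 c fun x hx => (h1 x hx).1, z2 b fun x hx => (h2 x hx).2,
    z2 a fun x hx => (h2 x hx).1] at h
  have h3 : ∀ p, pd₁ (fun p => η p * pd₁ φ p) p + pd₂ (fun p => η p * pd₂ φ p) p
      = η p * lap φ p + (pd₁ η p * pd₁ φ p + pd₂ η p * pd₂ φ p) := fun p => by
    have e1 := pd₁_mul h0 (contDiff_pd₁ hφ) p
    have e2 := pd₂_mul h0 (contDiff_pd₂ hφ) p
    rw [e1, e2, lap]; ring
  simp only [h3] at h
  have i1 : Continuous fun p => η p * lap φ p := h0.continuous.mul (contDiff_lap hφ).continuous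
  have i2 : Continuous fun p => pd₁ η p * pd₁ φ p + pd₂ η p * pd₂ φ p :=
    ((continuous_pd₁ h0).mul (continuous_pd₁ hφ)).add
      ((continuous_pd₂ h0).mul (continuous_pd₂ hφ))
  have h4 := integral_add (μ := volume.restrict (rect a b c d)) (i1.continuousOn.integrableOn_compact (isCompact_rect a b c d))
    (i2.continuousOn.integrableOn_compact (isCompact_rect a b c d))
  rw [h4] at h
  linarith

/-- Green's second identity. -/
theorem integral_mul_lap_comm (hab : a < b) (hcd : c < d) {φ η : ℝ × ℝ → ℝ}
    (hφ : φ ∈ dirichletTest a b c d) (hη : η ∈ dirichletTest a b c d) :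
    ∫ p in rect a b c d, η p * lap φ p = ∫ p in rect a b c d, φ p * lap η p := by
  rw [integral_mul_lap hab hcd hφ.1 hη, integral_mul_lap hab hcd hη.1 hφ]
  simp only [mul_comm]

theorem sineFun_mem_dirichletTest (hab : a < b) (hcd : c < d) (n : ℕ × ℕ) :
    sineFun a b c d n ∈ dirichletTest a b c d := by
  refine (mem_dirichletTest_iff hab hcd).2 ⟨contDiff_sineFun a b c d n, fun x _ => ?_, fun y _ => ?_⟩
  · simp [sineFun, sineMode_left, sineMode_right hcd]
  · simp [sineFun, sineMode_left, sineMode_right hab]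

theorem hasDerivAt_sin_angle (a b m x : ℝ) : HasDerivAt (fun x => Real.sin (m * angle a b x))
    (m * (Real.pi / (b - a)) * Real.cos (m * angle a b x)) x :=
  (((hasDerivAt_angle a b x).const_mul m).sin).congr_deriv (by ring)

theorem hasDerivAt_cos_angle (a b m x : ℝ) : HasDerivAt (fun x => Real.cos (m * angle a b x))
    (-(m * (Real.pi / (b - a))) * Real.sin (m * angle a b x)) x :=
  (((hasDerivAt_angle a b x).const_mul m).cos).congr_deriv (by ring)

theorem lap_sineFun (a b c d : ℝ) (n : ℕ × ℕ) (p : ℝ × ℝ) :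
    lap (sineFun a b c d n) p = -sineEig a b c d n * sineFun a b c d n p := by
  set N := Real.sqrt ((b - a) / 2 * ((d - c) / 2))⁻¹
  set m₁ : ℝ := (((n.1 : ℤ) + 1 : ℤ) : ℝ)
  set m₂ : ℝ := (((n.2 : ℤ) + 1 : ℤ) : ℝ)
  have hs := contDiff_sineFun a b c d n
  have h1 : pd₁ (sineFun a b c d n) = fun p => N * (m₁ * (Real.pi / (b - a)) *
      Real.cos (m₁ * angle a b p.1) * sineMode c d n.2 p.2) := funext fun p =>
    pd₁_eq (x := p.1) (s := p.2) (differentiableAt_of_smooth hs _)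
      (((hasDerivAt_sin_angle a b m₁ p.1).mul_const (sineMode c d n.2 p.2)).const_mul N)
  have h2 : pd₂ (sineFun a b c d n) = fun p => N * (sineMode a b n.1 p.1 *
      (m₂ * (Real.pi / (d - c)) * Real.cos (m₂ * angle c d p.2))) := funext fun p =>
    pd₂_eq (x := p.1) (s := p.2) (differentiableAt_of_smooth hs _)
      (((hasDerivAt_sin_angle c d m₂ p.2).const_mul (sineMode a b n.1 p.1)).const_mul N)
  have h3 : pd₁ (pd₁ (sineFun a b c d n)) p = N * (m₁ * (Real.pi / (b - a)) *
      (-(m₁ * (Real.pi / (b - a))) * Real.sin (m₁ * angle a b p.1)) * sineMode c d n.2 p.2) := by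
    refine pd₁_eq (x := p.1) (s := p.2) (differentiableAt_of_smooth (contDiff_pd₁ hs) _) ?_
    rw [h1]
    exact (((hasDerivAt_cos_angle a b m₁ p.1).const_mul (m₁ * (Real.pi / (b - a)))).mul_const
      (sineMode c d n.2 p.2)).const_mul N
  have h4 : pd₂ (pd₂ (sineFun a b c d n)) p = N * (sineMode a b n.1 p.1 *
      (m₂ * (Real.pi / (d - c)) * (-(m₂ * (Real.pi / (d - c))) * Real.sin (m₂ * angle c d p.2)))) := by
    refine pd₂_eq (x := p.1) (s := p.2) (differentiableAt_of_smooth (contDiff_pd₂ hs) _) ?_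
    rw [h2]
    exact (((hasDerivAt_cos_angle c d m₂ p.2).const_mul (m₂ * (Real.pi / (d - c)))).const_mul
      (sineMode a b n.1 p.1)).const_mul N
  rw [lap, h3, h4, sineFun, sineEig, sineMode, sineMode]
  simp only [m₁, m₂, N]
  push_cast
  ring

/-- The Laplacian of a test function, in `L²`. -/
def lapVec (a b c d : ℝ) : dirichletTest a b c d →ₗ[ℝ] L2Rect a b c d where
  toFun φ := (memLp_rect (contDiff_lap φ.2.1).continuous).toLp _
  map_add' φ ψ := by
    rw [← MemLp.toLp_add]
    refine MemLp.toLp_congr _ _ (.of_forall fun p => ?_)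
    have e1 : pd₁ (φ.1 + ψ.1) = pd₁ φ.1 + pd₁ ψ.1 := funext fun p => by
      rw [pd₁, fderiv_add (differentiableAt_of_smooth φ.2.1 p) (differentiableAt_of_smooth ψ.2.1 p)]
      rfl
    have e2 : pd₂ (φ.1 + ψ.1) = pd₂ φ.1 + pd₂ ψ.1 := funext fun p => by
      rw [pd₂, fderiv_add (differentiableAt_of_smooth φ.2.1 p) (differentiableAt_of_smooth ψ.2.1 p)]
      rfl
    change pd₁ (pd₁ (φ.1 + ψ.1)) p + pd₂ (pd₂ (φ.1 + ψ.1)) p = lap φ.1 p + lap ψ.1 p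
    rw [e1, e2, pd₁, fderiv_add (differentiableAt_of_smooth (contDiff_pd₁ φ.2.1) p)
      (differentiableAt_of_smooth (contDiff_pd₁ ψ.2.1) p), pd₂,
      fderiv_add (differentiableAt_of_smooth (contDiff_pd₂ φ.2.1) p)
      (differentiableAt_of_smooth (contDiff_pd₂ ψ.2.1) p)]
    simp only [lap, pd₁, pd₂, add_apply]
    ring
  map_smul' r φ := by
    rw [RingHom.id_apply, ← MemLp.toLp_const_smul]
    refine MemLp.toLp_congr _ _ (.of_forall fun p => ?_)
    have e1 : pd₁ (r • φ.1) = r • pd₁ φ.1 := funext fun p => by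
      rw [pd₁, fderiv_const_smul (differentiableAt_of_smooth φ.2.1 p)]
      rfl
    have e2 : pd₂ (r • φ.1) = r • pd₂ φ.1 := funext fun p => by
      rw [pd₂, fderiv_const_smul (differentiableAt_of_smooth φ.2.1 p)]
      rfl
    change pd₁ (pd₁ (r • φ.1)) p + pd₂ (pd₂ (r • φ.1)) p = r * lap φ.1 p
    rw [e1, e2, pd₁, fderiv_const_smul (differentiableAt_of_smooth (contDiff_pd₁ φ.2.1) p), pd₂,
      fderiv_const_smul (differentiableAt_of_smooth (contDiff_pd₂ φ.2.1) p)]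
    simp only [lap, pd₁, pd₂, smul_apply, smul_eq_mul]
    ring

theorem continuous_pd₂_edge {φ : ℝ × ℝ → ℝ} (hφ : ContDiff ℝ ∞ φ) (e : ℝ) :
    Continuous fun x => pd₂ φ (x, e) := by
  have := continuous_pd₂ hφ
  fun_prop

/-- The normal derivative of a test function on the line where the second variable is `e`. -/
def normalDeriv (a b c d e : ℝ) : dirichletTest a b c d →ₗ[ℝ] L2Seg a b where
  toFun φ := (memLp_seg (continuous_pd₂_edge φ.2.1 e)).toLp _
  map_add' φ ψ := by
    rw [← MemLp.toLp_add]
    refine MemLp.toLp_congr _ _ (.of_forall fun x => ?_)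
    change pd₂ (φ.1 + ψ.1) (x, e) = pd₂ φ.1 (x, e) + pd₂ ψ.1 (x, e)
    rw [pd₂, fderiv_add (differentiableAt_of_smooth φ.2.1 _) (differentiableAt_of_smooth ψ.2.1 _)]
    rfl
  map_smul' r φ := by
    rw [RingHom.id_apply, ← MemLp.toLp_const_smul]
    refine MemLp.toLp_congr _ _ (.of_forall fun x => ?_)
    change pd₂ (r • φ.1) (x, e) = r * pd₂ φ.1 (x, e)
    rw [pd₂, fderiv_const_smul (differentiableAt_of_smooth φ.2.1 _)]
    rfl

/-- A test function, in `L²`. -/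
def testVec (φ : dirichletTest a b c d) : L2Rect a b c d := (memLp_rect φ.2.1.continuous).toLp _

theorem inner_toLp_toLp {φ ψ : ℝ × ℝ → ℝ} (hφ : Continuous φ) (hψ : Continuous ψ) :
    inner ℝ ((memLp_rect hφ).toLp φ : L2Rect a b c d) ((memLp_rect hψ).toLp ψ)
      = ∫ p in rect a b c d, φ p * ψ p := by
  rw [← setIntegral_rect_mul_eq_inner _ hφ]
  refine integral_congr_ae ?_
  filter_upwards [(memLp_rect (a := a) (b := b) (c := c) (d := d) hψ).coeFn_toLp] with p hp
  rw [hp, mul_comm]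

/-- Green's second identity against an eigenfunction. This is the diagonal relation that
`exists_diagonal_solution` demands of its pairs `φ`, `ψ`. -/
theorem inner_sineVec_lapVec (hab : a < b) (hcd : c < d) (φ : dirichletTest a b c d) (n : ℕ × ℕ) :
    inner ℝ (sineVec a b c d n) (lapVec a b c d φ)
      = -sineEig a b c d n * inner ℝ (sineVec a b c d n) (testVec φ) := by
  have h1 := inner_toLp_toLp (a := a) (b := b) (c := c) (d := d)
    (contDiff_sineFun a b c d n).continuous (contDiff_lap φ.2.1).continuous
  have h2 := inner_toLp_toLp (a := a) (b := b) (c := c) (d := d)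
    (contDiff_sineFun a b c d n).continuous φ.2.1.continuous
  have h3 := integral_mul_lap_comm hab hcd φ.2 (sineFun_mem_dirichletTest hab hcd n)
  rw [sineVec, testVec, h2]
  refine h1.trans (h3.trans ?_)
  rw [← integral_const_mul]
  refine integral_congr_ae (.of_forall fun p => ?_)
  simp only [lap_sineFun]
  ring

/-! ### The spectral gap, Rellich's estimate and the Dirichlet map -/

/-- The lower bound of the Dirichlet spectrum of a rectangle. -/
def specGap (a b c d : ℝ) : ℝ := (Real.pi / (b - a)) ^ 2 + (Real.pi / (d - c)) ^ 2

theorem specGap_pos (hab : a < b) (hcd : c < d) : 0 < specGap a b c d := by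
  have h1 : 0 < Real.pi / (b - a) := div_pos Real.pi_pos (sub_pos.2 hab)
  have h2 : 0 < Real.pi / (d - c) := div_pos Real.pi_pos (sub_pos.2 hcd)
  unfold specGap; positivity

/-- Every eigenfunction is a nonzero multiple of its own Laplacian, so the range contains the span
of a Hilbert basis. Density lets an operator bounded by `‖Δφ‖` extend to all of `L²`. -/
theorem denseRange_lapVec (hab : a < b) (hcd : c < d) : DenseRange (lapVec a b c d) := by
  have h1 := (sineBasis hab hcd).dense_span
  have h2 : Submodule.span ℝ (range (sineBasis hab hcd)) ≤ LinearMap.range (lapVec a b c d) := by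
    rw [Submodule.span_le]
    rintro _ ⟨n, rfl⟩
    have hne : -sineEig a b c d n ≠ 0 :=
      (neg_lt_zero.2 ((specGap_pos hab hcd).trans_le (sineEig_ge hab hcd n))).ne
    have h3 : lapVec a b c d ⟨_, sineFun_mem_dirichletTest hab hcd n⟩
        = (-sineEig a b c d n) • sineVec a b c d n := by
      rw [sineVec, ← MemLp.toLp_const_smul]
      exact MemLp.toLp_congr (memLp_rect (contDiff_lap (contDiff_sineFun a b c d n)).continuous) _
        (.of_forall fun p => lap_sineFun a b c d n p)
    rw [sineBasis_apply]
    refine ⟨(-sineEig a b c d n)⁻¹ • ⟨_, sineFun_mem_dirichletTest hab hcd n⟩, ?_⟩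
    rw [map_smul, h3, inv_smul_smul₀ hne]
  have h3 := Submodule.topologicalClosure_mono h2
  rw [h1, top_le_iff] at h3
  rw [DenseRange, ← LinearMap.coe_range]
  exact Submodule.dense_iff_topologicalClosure_eq_top.2 h3

/-- Poincaré's inequality. -/
theorem specGap_mul_norm_testVec_le (hab : a < b) (hcd : c < d) (φ : dirichletTest a b c d) :
    specGap a b c d ^ 2 * ‖testVec φ‖ ^ 2 ≤ ‖lapVec a b c d φ‖ ^ 2 := by
  have hs : ∀ v : L2Rect a b c d, Summable fun n => inner ℝ (sineBasis hab hcd n) v ^ 2 := fun v =>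
    summable_of_sum_le (fun i => sq_nonneg _) (sum_inner_sq_le (sineBasis hab hcd) v)
  rw [norm_sq_eq_tsum (sineBasis hab hcd), norm_sq_eq_tsum (sineBasis hab hcd), ← tsum_mul_left]
  refine Summable.tsum_le_tsum (fun n => ?_) ((hs _).mul_left _) (hs _)
  rw [sineBasis_apply, inner_sineVec_lapVec hab hcd, mul_pow, neg_sq]
  have h1 : specGap a b c d ≤ sineEig a b c d n := sineEig_ge hab hcd n
  have h2 := specGap_pos hab hcd
  gcongr

/-- Rellich's identity. -/
theorem integral_normalDeriv_sq (hab : a < b) (hcd : c < d) {φ : ℝ × ℝ → ℝ}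
    (hφ : φ ∈ dirichletTest a b c d) :
    (∫ x in Icc a b, pd₂ φ (x, d) ^ 2) + ∫ x in Icc a b, pd₂ φ (x, c) ^ 2
      = ∫ p in rect a b c d, (2 * ((2 * p.2 - c - d) / (d - c)) * (pd₂ φ p * lap φ p)
          + 2 / (d - c) * (pd₂ φ p ^ 2 - pd₁ φ p ^ 2)) := by
  obtain ⟨h0, h1, h2⟩ := (mem_dirichletTest_iff hab hcd).1 hφ
  have hcd0 : d - c ≠ 0 := (sub_pos.2 hcd).ne'
  have s1 := contDiff_pd₁ h0
  have s2 := contDiff_pd₂ h0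
  -- The multiplier is affine in the second variable, `1` on the upper edge and `-1` on the lower
  -- one, so both edges contribute with a positive sign.
  set q : ℝ × ℝ → ℝ := fun p => (2 * p.2 - c - d) / (d - c) with hq
  have hqs : ContDiff ℝ ∞ q := by
    have : ContDiff ℝ ∞ fun p : ℝ × ℝ => 2 * p.2 - c - d :=
      ((contDiff_const.mul contDiff_snd).sub contDiff_const).sub contDiff_const
    exact this.div_const _
  have hq1 : ∀ p, pd₁ q p = 0 := fun p =>
    pd₁_eq (x := p.1) (s := p.2) (differentiableAt_of_smooth hqs _) 
      (hasDerivAt_const p.1 ((2 * p.2 - c - d) / (d - c)))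
  have hq2 : ∀ p, pd₂ q p = 2 / (d - c) := fun p => by
    refine pd₂_eq (x := p.1) (s := p.2) (differentiableAt_of_smooth hqs _) ?_
    have := ((((hasDerivAt_id p.2).const_mul 2).sub_const c).sub_const d).div_const (d - c)
    rw [mul_one] at this
    exact this
  have sF : ContDiff ℝ ∞ fun p => pd₁ φ p * pd₂ φ p := s1.mul s2
  have sG1 : ContDiff ℝ ∞ fun p => pd₂ φ p * pd₂ φ p := s2.mul s2
  have sG2 : ContDiff ℝ ∞ fun p => pd₁ φ p * pd₁ φ p := s1.mul s1
  have sG : ContDiff ℝ ∞ fun p => pd₂ φ p * pd₂ φ p - pd₁ φ p * pd₁ φ p := sG1.sub sG2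
  have two : ContDiff ℝ ∞ fun _ : ℝ × ℝ => (2 : ℝ) := contDiff_const
  -- The field `(2 φ_x φ_y, φ_y² - φ_x²)` has divergence `2 φ_y Δφ`: the mixed terms cancel. On the
  -- boundary tangential derivatives vanish, which kills the flux through the vertical edges and
  -- leaves `φ_y²` on the horizontal ones.
  have hdiv := integral_divergence_rect hab.le hcd.le
    (F := fun p => q p * (2 * (pd₁ φ p * pd₂ φ p)))
    (G := fun p => q p * (pd₂ φ p * pd₂ φ p - pd₁ φ p * pd₁ φ p)) (hqs.mul (two.mul sF))
    (hqs.mul sG)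
  have b1 : ∀ x ∈ Icc a b, pd₁ φ (x, c) = 0 ∧ pd₁ φ (x, d) = 0 := fun x hx =>
    ⟨deriv_eq_zero_of_eqOn_Icc hab (fun x hx => (h1 x hx).1) hx
      (hasDerivAt_fst (differentiableAt_of_smooth h0 _)),
    deriv_eq_zero_of_eqOn_Icc hab (fun x hx => (h1 x hx).2) hx
      (hasDerivAt_fst (differentiableAt_of_smooth h0 _))⟩
  have b2 : ∀ y ∈ Icc c d, pd₂ φ (a, y) = 0 ∧ pd₂ φ (b, y) = 0 := fun y hy =>
    ⟨deriv_eq_zero_of_eqOn_Icc hcd (fun x hx => (h2 x hx).1) hy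
      (hasDerivAt_snd (differentiableAt_of_smooth h0 _)),
    deriv_eq_zero_of_eqOn_Icc hcd (fun x hx => (h2 x hx).2) hy
      (hasDerivAt_snd (differentiableAt_of_smooth h0 _))⟩
  have hqd : ∀ x : ℝ, q (x, d) = 1 := fun x => by
    simp only [hq]; rw [div_eq_one_iff_eq hcd0]; ring
  have hqc : ∀ x : ℝ, q (x, c) = -1 := fun x => by
    simp only [hq]; rw [div_eq_iff hcd0]; ring
  have e1 : ∫ x in Icc a b, q (x, d) * (pd₂ φ (x, d) * pd₂ φ (x, d) - pd₁ φ (x, d) * pd₁ φ (x, d))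
      = ∫ x in Icc a b, pd₂ φ (x, d) ^ 2 :=
    setIntegral_congr_fun measurableSet_Icc fun x hx => by
      simp only [hqd, (b1 x hx).2]; ring
  have e2 : ∫ x in Icc a b, q (x, c) * (pd₂ φ (x, c) * pd₂ φ (x, c) - pd₁ φ (x, c) * pd₁ φ (x, c))
      = -∫ x in Icc a b, pd₂ φ (x, c) ^ 2 := by
    rw [← integral_neg]
    exact setIntegral_congr_fun measurableSet_Icc fun x hx => by
      simp only [hqc, (b1 x hx).1]; ring
  have e3 : ∫ y in Icc c d, q (b, y) * (2 * (pd₁ φ (b, y) * pd₂ φ (b, y))) = 0 :=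
    setIntegral_eq_zero_of_forall_eq_zero fun y hy => by rw [(b2 y hy).2]; ring
  have e4 : ∫ y in Icc c d, q (a, y) * (2 * (pd₁ φ (a, y) * pd₂ φ (a, y))) = 0 :=
    setIntegral_eq_zero_of_forall_eq_zero fun y hy => by rw [(b2 y hy).1]; ring
  rw [e1, e2, e3, e4, sub_neg_eq_add, sub_zero, add_zero] at hdiv
  rw [← hdiv]
  refine integral_congr_ae (.of_forall fun p => ?_)
  have g1 : pd₁ (fun p => q p * (2 * (pd₁ φ p * pd₂ φ p))) p
      = q p * (2 * (pd₁ (pd₁ φ) p * pd₂ φ p + pd₁ φ p * pd₂ (pd₁ φ) p)) := by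
    have z : pd₁ (fun _ : ℝ × ℝ => (2 : ℝ)) p = 0 := by simp [pd₁]
    rw [pd₁_mul hqs (two.mul sF), hq1, pd₁_mul two sF, pd₁_mul s1 s2, pd₁_pd₂ h0, z]
    ring
  have g2 : pd₂ (fun p => q p * (pd₂ φ p * pd₂ φ p - pd₁ φ p * pd₁ φ p)) p
      = 2 / (d - c) * (pd₂ φ p ^ 2 - pd₁ φ p ^ 2)
        + q p * (2 * pd₂ φ p * pd₂ (pd₂ φ) p - 2 * pd₁ φ p * pd₂ (pd₁ φ) p) := by
    have z : pd₂ (fun p => pd₂ φ p * pd₂ φ p - pd₁ φ p * pd₁ φ p) p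
        = pd₂ (fun p => pd₂ φ p * pd₂ φ p) p - pd₂ (fun p => pd₁ φ p * pd₁ φ p) p := by
      rw [pd₂, fderiv_fun_sub (differentiableAt_of_smooth sG1 p) (differentiableAt_of_smooth sG2 p)]
      rfl
    rw [pd₂_mul hqs sG, hq2, z, pd₂_mul s2 s2, pd₂_mul s1 s1]
    ring
  simp only [g1, g2, lap]
  simp only [hq]
  ring

theorem integrable_rect_of_continuous {ψ : ℝ × ℝ → ℝ} (hψ : Continuous ψ) :
    Integrable ψ (volume.restrict (rect a b c d)) :=
  hψ.continuousOn.integrableOn_compact (isCompact_rect a b c d)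

/-- The energy estimate for test functions. -/
theorem specGap_mul_integral_grad_le (hab : a < b) (hcd : c < d) (φ : dirichletTest a b c d) :
    specGap a b c d * ((∫ p in rect a b c d, pd₁ φ p ^ 2) + ∫ p in rect a b c d, pd₂ φ p ^ 2)
      ≤ ‖lapVec a b c d φ‖ ^ 2 := by
  have hκ := specGap_pos hab hcd
  have h1 := integral_mul_lap hab hcd φ.2.1 φ.2
  have h2 : inner ℝ (testVec φ) (lapVec a b c d φ) = ∫ p in rect a b c d, φ.1 p * lap φ p :=
    inner_toLp_toLp φ.2.1.continuous (contDiff_lap φ.2.1).continuous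
  have c1 := continuous_pd₁ φ.2.1
  have c2 := continuous_pd₂ φ.2.1
  simp only [← sq] at h1
  rw [integral_add (integrable_rect_of_continuous (by fun_prop))
    (integrable_rect_of_continuous (by fun_prop))] at h1
  -- The gradient integral equals `-⟨φ, Δφ⟩`, so Cauchy–Schwarz and this form of Poincaré's
  -- inequality conclude.
  have h3 : specGap a b c d * ‖testVec φ‖ ≤ ‖lapVec a b c d φ‖ := by
    refine abs_le_of_sq_le_sq ?_ (norm_nonneg _) |> le_of_abs_le
    rw [mul_pow]
    exact specGap_mul_norm_testVec_le hab hcd φ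
  have h4 := abs_le.1 (abs_real_inner_le_norm (testVec φ) (lapVec a b c d φ))
  have h5 := norm_nonneg (lapVec a b c d φ)
  nlinarith

/-- The normal derivatives of a test function on the horizontal edges are controlled by its
Laplacian. -/
theorem norm_normalDeriv_sq_le (hab : a < b) (hcd : c < d) (φ : dirichletTest a b c d) :
    ‖normalDeriv a b c d d φ‖ ^ 2 + ‖normalDeriv a b c d c φ‖ ^ 2
      ≤ (1 + (1 + 2 / (d - c)) / specGap a b c d) * ‖lapVec a b c d φ‖ ^ 2 := by
  have hκ := specGap_pos hab hcd
  have hdc : 0 < d - c := sub_pos.2 hcd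
  have hE := specGap_mul_integral_grad_le hab hcd φ
  have c1 := continuous_pd₁ φ.2.1
  have c2 := continuous_pd₂ φ.2.1
  have c3 := (contDiff_lap φ.2.1).continuous
  set X := ∫ p in rect a b c d, pd₁ φ p ^ 2
  set Y := ∫ p in rect a b c d, pd₂ φ p ^ 2
  have hX : 0 ≤ X := integral_nonneg fun p => sq_nonneg _
  have hQ : ‖lapVec a b c d φ‖ ^ 2 = ∫ p in rect a b c d, lap φ p ^ 2 :=
    norm_toLp_sq (memLp_rect c3)
  have hd : ‖normalDeriv a b c d d φ‖ ^ 2 = ∫ x in Icc a b, pd₂ φ (x, d) ^ 2 :=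
    norm_toLp_sq (memLp_seg (continuous_pd₂_edge φ.2.1 d))
  have hc : ‖normalDeriv a b c d c φ‖ ^ 2 = ∫ x in Icc a b, pd₂ φ (x, c) ^ 2 :=
    norm_toLp_sq (memLp_seg (continuous_pd₂_edge φ.2.1 c))
  rw [hd, hc, integral_normalDeriv_sq hab hcd φ.2]
  -- Pointwise: `2 q φ_y Δφ ≤ q² φ_y² + (Δφ)²` with `q² ≤ 1`, and the term in `φ_x²` has a
  -- favourable sign.
  have hle : ∫ p in rect a b c d, (2 * ((2 * p.2 - c - d) / (d - c)) * (pd₂ φ p * lap φ p)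
          + 2 / (d - c) * (pd₂ φ p ^ 2 - pd₁ φ p ^ 2))
      ≤ ∫ p in rect a b c d, ((1 + 2 / (d - c)) * pd₂ φ p ^ 2 + lap φ p ^ 2) := by
    refine integral_mono_ae (integrable_rect_of_continuous (by fun_prop))
      (integrable_rect_of_continuous (by fun_prop)) ?_
    filter_upwards [ae_restrict_mem (measurableSet_rect a b c d)] with p hp
    have hq : ((2 * p.2 - c - d) / (d - c)) ^ 2 ≤ 1 := by
      rw [div_pow, div_le_one (by positivity)]
      have := hp.2.1
      have := hp.2.2
      nlinarith
    have h1 : 0 ≤ 2 / (d - c) * pd₁ φ p ^ 2 := by positivity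
    have h2 := sq_nonneg ((2 * p.2 - c - d) / (d - c) * pd₂ φ p - lap φ p)
    have h3 := mul_le_mul_of_nonneg_right hq (sq_nonneg (pd₂ φ p))
    nlinarith
  refine hle.trans ?_
  rw [integral_add (integrable_rect_of_continuous (by fun_prop))
    (integrable_rect_of_continuous (by fun_prop)), integral_const_mul, ← hQ]
  have hY : Y ≤ ‖lapVec a b c d φ‖ ^ 2 / specGap a b c d := by
    rw [le_div_iff₀ hκ]; nlinarith
  have h4 : 0 ≤ 1 + 2 / (d - c) := by positivity
  calc (1 + 2 / (d - c)) * Y + ‖lapVec a b c d φ‖ ^ 2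
      ≤ (1 + 2 / (d - c)) * (‖lapVec a b c d φ‖ ^ 2 / specGap a b c d)
        + ‖lapVec a b c d φ‖ ^ 2 := by gcongr
    _ = _ := by ring

/-- The Dirichlet map: bounded operators solving `Δ v = 0` in the very weak sense with prescribed
boundary values on one horizontal edge. -/
theorem exists_dirichletMap (hab : a < b) (hcd : c < d) {e : ℝ} (he : e = d ∨ e = c) :
    ∃ D : L2Seg a b →L[ℝ] L2Rect a b c d, ∀ (φ : dirichletTest a b c d) (g : L2Seg a b),
      inner ℝ (lapVec a b c d φ) (D g) = ∫ x in Icc a b, g x * pd₂ φ (x, e) := by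
  set C := 1 + (1 + 2 / (d - c)) / specGap a b c d
  have hC : ∀ φ, ‖normalDeriv a b c d e φ‖ ≤ Real.sqrt C * ‖lapVec a b c d φ‖ := by
    intro φ
    have hC0 : 0 ≤ C := by
      have := specGap_pos hab hcd
      have : 0 < d - c := sub_pos.2 hcd
      positivity
    refine abs_le_of_sq_le_sq ?_ (by positivity) |> le_of_abs_le
    rw [mul_pow, Real.sq_sqrt hC0]
    have h := norm_normalDeriv_sq_le hab hcd φ
    have h1 := sq_nonneg ‖normalDeriv a b c d d φ‖
    have h2 := sq_nonneg ‖normalDeriv a b c d c φ‖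
    rcases he with rfl | rfl <;> linarith
  -- Transposition: `Δφ ↦ φ_y(·, e)` is bounded on a dense range, hence extends to `L²`, and its
  -- adjoint is `D`. On the lower edge the outward normal derivative is `-φ_y`, so there `D g`
  -- corresponds to the boundary value `-g`.
  refine ⟨((normalDeriv a b c d e).extendOfNorm (lapVec a b c d)).adjoint, fun φ g => ?_⟩
  rw [ContinuousLinearMap.adjoint_inner_right,
    LinearMap.extendOfNorm_eq (denseRange_lapVec hab hcd) ⟨_, hC⟩,
    setIntegral_seg_mul_eq_inner g (continuous_pd₂_edge φ.2.1 e)]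
  rfl

/-! ### The heat equation: existence and uniqueness -/

/-- The coefficients of `D g` are the pairings of `g` with the vectors `D* eₙ`, and these satisfy
Bessel's inequality with constant `‖D‖²` because `∑ ⟨eₙ, D f⟩² ≤ ‖D f‖²`. -/
theorem exists_lift_coeff_bound {L l τ : ℝ} (hL : -L < L) (hl : -l < l) (hτ : 0 < τ)
    (D : L2Seg (-L) L →L[ℝ] L2Rect (-L) L (-l) l) (ζ : L2Rect (-L) L 0 τ) :
    ∃ A : ℕ × ℕ → ℝ, (∀ i, 0 ≤ A i) ∧
      (∀ F : Finset (ℕ × ℕ), ∑ i ∈ F, A i ^ 2 ≤ τ * (‖D‖ ^ 2 * ‖ζ‖ ^ 2)) ∧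
      ∀ t, 0 ≤ t → ∀ i, |inner ℝ (sineBasis hL hl i) (D (lowerTrace (shift t ζ)))| ≤ A i := by
  have h := exists_coeff_bound (fun i => D.adjoint (sineBasis hL hl i)) (C := ‖D‖ ^ 2)
    (fun F f => ?_) hτ ζ
  · simpa only [sub_zero, ContinuousLinearMap.adjoint_inner_left] using h
  · simp only [ContinuousLinearMap.adjoint_inner_left]
    refine (sum_inner_sq_le _ _ F).trans ?_
    rw [← mul_pow]
    exact pow_le_pow_left₀ (norm_nonneg _) (D.le_opNorm f) 2

/-- The boundary values at `s = 0` of the transport solution. -/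
def inflow (u : H1 a b c d) (t : ℝ) : L2Seg a b := lowerTrace (shift (max t 0) (h1Wd₂ u))

theorem hasLowerTrace_inflow {L τ : ℝ} (u : H1 (-L) L 0 τ) (hu : HasUpperTrace u 0) {t : ℝ}
    (ht : 0 ≤ t) : HasLowerTrace (transport u hu t) (inflow u t) :=
  hasLowerTrace_lowerTrace _ ((isTransportSolution_transport u hu).boundary t ht)

/-- Existence for the heat equation driven by transport solutions, with exponential decay. -/
theorem exists_heatSolution {L l τ : ℝ} (hL : -L < L) (hl : -l < l) (hτ : 0 < τ) :
    ∃ K : ℝ, 0 ≤ K ∧ ∀ (w₀ : L2Rect (-L) L (-l) l) (z₁ z₂ : H1 (-L) L 0 τ),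
      ∃ w, IsHeatSolution L l w₀ (inflow z₁) (inflow z₂) w ∧ ∀ t, 0 ≤ t →
        ‖w t‖ ^ 2 ≤ Real.exp (2 * specGap (-L) L (-l) l * (τ - t)) *
          (2 * (‖w₀‖ ^ 2 + K * (h1NormSq z₁ + h1NormSq z₂))) := by
  obtain ⟨D₁, hD₁⟩ := exists_dirichletMap hL hl (e := l) (Or.inl rfl)
  obtain ⟨D₂, hD₂⟩ := exists_dirichletMap hL hl (e := -l) (Or.inr rfl)
  -- The factor `2` comes from `(A₁ + A₂)² ≤ 2 A₁² + 2 A₂²`, and `τ ‖Dᵢ‖²` from the coefficient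
  -- bound of each lift.
  refine ⟨2 * τ * (‖D₁‖ ^ 2 + ‖D₂‖ ^ 2), by positivity, fun w₀ z₁ z₂ => ?_⟩
  obtain ⟨A₁, p₁, s₁, b₁⟩ := exists_lift_coeff_bound hL hl hτ D₁ (h1Wd₂ z₁)
  obtain ⟨A₂, p₂, s₂, b₂⟩ := exists_lift_coeff_bound hL hl hτ D₂ (h1Wd₂ z₂)
  have hζ : ∀ z : H1 (-L) L 0 τ, ‖h1Wd₂ z‖ ^ 2 ≤ h1NormSq z := fun z => by
    have h1 := sq_nonneg ‖h1Fn z‖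
    have h2 := sq_nonneg ‖h1Wd₁ z‖
    rw [h1NormSq]; linarith
  have hgc : ∀ z : H1 (-L) L 0 τ, Continuous (inflow z) := fun z =>
    continuous_lowerTrace.comp ((continuous_shift _).comp (continuous_id.max continuous_const))
  have hgz : ∀ (z : H1 (-L) L 0 τ) (t : ℝ), τ ≤ t → inflow z t = 0 := fun z t ht => by
    rw [inflow, shift_eq_zero (by rw [sub_zero]; exact ht.trans (le_max_left _ _)), lowerTrace]
    simp
  have hM : ∀ F : Finset (ℕ × ℕ), ∑ i ∈ F, (A₁ i + A₂ i) ^ 2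
      ≤ 2 * τ * (‖D₁‖ ^ 2 + ‖D₂‖ ^ 2) * (h1NormSq z₁ + h1NormSq z₂) := by
    intro F
    have e1 := s₁ F
    have e2 := s₂ F
    have f1 := hζ z₁
    have f2 := hζ z₂
    have n1 : 0 ≤ h1NormSq z₁ := (sq_nonneg _).trans f1
    have n2 : 0 ≤ h1NormSq z₂ := (sq_nonneg _).trans f2
    have g1 : τ * (‖D₁‖ ^ 2 * ‖h1Wd₂ z₁‖ ^ 2) ≤ τ * (‖D₁‖ ^ 2 * h1NormSq z₁) := by gcongr
    have g2 : τ * (‖D₂‖ ^ 2 * ‖h1Wd₂ z₂‖ ^ 2) ≤ τ * (‖D₂‖ ^ 2 * h1NormSq z₂) := by gcongr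
    have g3 : 0 ≤ τ * (‖D₁‖ ^ 2 * h1NormSq z₂) := by positivity
    have g4 : 0 ≤ τ * (‖D₂‖ ^ 2 * h1NormSq z₁) := by positivity
    calc ∑ i ∈ F, (A₁ i + A₂ i) ^ 2 ≤ ∑ i ∈ F, (2 * A₁ i ^ 2 + 2 * A₂ i ^ 2) :=
          Finset.sum_le_sum fun i _ => by nlinarith [sq_nonneg (A₁ i - A₂ i)]
      _ = 2 * ∑ i ∈ F, A₁ i ^ 2 + 2 * ∑ i ∈ F, A₂ i ^ 2 := by
          rw [Finset.sum_add_distrib, ← Finset.mul_sum, ← Finset.mul_sum]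
      _ ≤ _ := by linarith
  have hA : ∀ t, 0 ≤ t → ∀ i, |inner ℝ (sineBasis hL hl i)
      (D₁ (inflow z₁ t) - D₂ (inflow z₂ t))| ≤ A₁ i + A₂ i := by
    intro t ht i
    simp only [inflow, max_eq_left ht]
    rw [inner_sub_right]
    exact (abs_sub _ _).trans (add_le_add (b₁ t ht i) (b₂ t ht i))
  -- The minus sign before `D₂` matches the opposite signs of the two boundary terms in the weak
  -- formulation.
  obtain ⟨w, hw, hw0, hwb, hwd⟩ := exists_diagonal_solution (sineBasis hL hl)
    (specGap_pos hL hl).le (Λ := sineEig (-L) L (-l) l) (sineEig_ge hL hl)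
    (h := fun t => D₁ (inflow z₁ t) - D₂ (inflow z₂ t))
    ((D₁.continuous.comp (hgc z₁)).sub (D₂.continuous.comp (hgc z₂)))
    (A := fun i => A₁ i + A₂ i) (fun i => add_nonneg (p₁ i) (p₂ i))
    hM hA hτ.le (fun t ht => by simp only [hgz _ t ht, map_zero, sub_zero]) w₀
  refine ⟨w, ⟨hw.continuousOn, hw0, fun φ h1 h2 t ht => ?_⟩, hwb⟩
  set φ' : dirichletTest (-L) L (-l) l := ⟨φ, h1, h2⟩
  have h3 := hwd (testVec φ') (lapVec _ _ _ _ φ')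
    (fun i => by rw [sineBasis_apply]; exact inner_sineVec_lapVec hL hl φ' i) t ht
  rw [inner_sub_right, inner_sub_right, hD₁, hD₂] at h3
  have h4 : ∀ r, ∫ p in rect (-L) L (-l) l, w r p * φ p = inner ℝ (testVec φ') (w r) := fun r =>
    setIntegral_rect_mul_eq_inner _ h1.continuous
  have h5 : ∫ p in rect (-L) L (-l) l, w t p * lap φ p
      = inner ℝ (lapVec _ _ _ _ φ') (w t) :=
    setIntegral_rect_mul_eq_inner _ (contDiff_lap h1).continuous
  simp only [h4, h5]
  rw [sub_add]
  exact h3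

/-- The lower trace of a function is unique. -/
theorem HasLowerTrace.integral_congr (hcd : c < d) {u : H1 a b c d} {g g' : L2Seg a b}
    (hg : HasLowerTrace u g) (hg' : HasLowerTrace u g') {ψ : ℝ → ℝ} (hψ : ContDiff ℝ ∞ ψ) :
    ∫ x in Icc a b, g x * ψ x = ∫ x in Icc a b, g' x * ψ x := by
  -- This test function interpolates linearly between `ψ` on the lower edge and `0` on the upper
  -- edge.
  have h1 : ContDiff ℝ ∞ fun p : ℝ × ℝ => ψ p.1 * ((d - p.2) / (d - c)) :=
    (hψ.comp contDiff_fst).mul ((contDiff_const.sub contDiff_snd).div_const _)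
  have h2 := (hg _ h1 fun x _ => by simp).symm.trans (hg' _ h1 fun x _ => by simp)
  simp only [div_self (sub_pos.2 hcd).ne', mul_one] at h2
  exact neg_injective h2

/-- Uniqueness for the heat equation. -/
theorem IsHeatSolution.eqOn {L l : ℝ} (hL : -L < L) (hl : -l < l) {w₀ : L2Rect (-L) L (-l) l}
    {g₁ g₂ g₁' g₂' : ℝ → L2Seg (-L) L} {w w' : ℝ → L2Rect (-L) L (-l) l}
    (hw : IsHeatSolution L l w₀ g₁ g₂ w) (hw' : IsHeatSolution L l w₀ g₁' g₂' w')
    (h₁ : ∀ t ∈ Ici (0 : ℝ), ∀ ψ : ℝ → ℝ, ContDiff ℝ ∞ ψ →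
      ∫ x in Icc (-L) L, g₁ t x * ψ x = ∫ x in Icc (-L) L, g₁' t x * ψ x)
    (h₂ : ∀ t ∈ Ici (0 : ℝ), ∀ ψ : ℝ → ℝ, ContDiff ℝ ∞ ψ →
      ∫ x in Icc (-L) L, g₂ t x * ψ x = ∫ x in Icc (-L) L, g₂' t x * ψ x) :
    EqOn w w' (Ici 0) := by
  intro t ht
  -- Tested against an eigenfunction, the boundary terms of the two solutions cancel. The
  -- coefficient of the difference solves `y' = -λ y` with `y(0) = 0`, so its square is
  -- nonincreasing and stays zero.
  have hcoef : ∀ n, inner ℝ (sineVec (-L) L (-l) l n) (w t - w' t) = 0 := by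
    intro n
    have hs := sineFun_mem_dirichletTest hL hl n
    have hd : ∀ r ∈ Ici (0 : ℝ), HasDerivWithinAt
        (fun r => inner ℝ (sineVec (-L) L (-l) l n) (w r - w' r))
        (-sineEig (-L) L (-l) l n * inner ℝ (sineVec (-L) L (-l) l n) (w r - w' r)) (Ici 0) r := by
      intro r hr
      have e := (hw.equation _ hs.1 hs.2 r hr).sub (hw'.equation _ hs.1 hs.2 r hr)
      have hψ : ∀ y, ContDiff ℝ ∞ fun x => pd₂ (sineFun (-L) L (-l) l n) (x, y) := fun y =>
        (contDiff_pd₂ hs.1).comp (contDiff_id.prodMk contDiff_const)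
      have hlap : ∀ v : L2Rect (-L) L (-l) l,
          ∫ p in rect (-L) L (-l) l, v p * lap (sineFun (-L) L (-l) l n) p
            = -sineEig (-L) L (-l) l n * inner ℝ (sineVec (-L) L (-l) l n) v := fun v => by
        rw [inner_sineVec, ← integral_const_mul]
        refine integral_congr_ae (.of_forall fun p => ?_)
        simp only [lap_sineFun]; ring
      rw [h₁ r hr _ (hψ l), h₂ r hr _ (hψ (-l)), hlap, hlap] at e
      simp only [← inner_sineVec] at e
      simp only [inner_sub_right]
      refine e.congr_deriv ?_
      ring
    have hanti : AntitoneOn (fun r => inner ℝ (sineVec (-L) L (-l) l n) (w r - w' r) ^ 2)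
        (Ici 0) := by
      refine antitoneOn_of_hasDerivWithinAt_nonpos (convex_Ici 0)
        (fun r hr => ((hd r hr).pow 2).continuousWithinAt)
        (fun r hr => ((hd r (interior_subset hr)).pow 2).mono interior_subset) fun r _ => ?_
      have h1 := (specGap_pos hL hl).le.trans (sineEig_ge hL hl n)
      have h2 := mul_nonneg h1 (sq_nonneg (inner ℝ (sineVec (-L) L (-l) l n) (w r - w' r)))
      simp only [Nat.cast_ofNat, Nat.add_one_sub_one, pow_one]
      nlinarith
    have h0 := hanti self_mem_Ici ht ht
    simp only [hw.initial, hw'.initial, sub_self, inner_zero_right] at h0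
    nlinarith
  have h3 := norm_sq_eq_tsum (sineBasis hL hl) (w t - w' t)
  simp only [sineBasis_apply, hcoef] at h3
  rw [← sub_eq_zero, ← norm_eq_zero, ← sq_eq_zero_iff, h3]
  simp

/-! ### Exponential bounds, the zero solution and the proposition -/

/-- Extinction at time `τ` allows any rate: up to `τ` the exponential is at least `1`, and
afterwards the left side is zero. The rate can thus be matched to that of the heat part. -/
theorem h1NormSq_transport_le_exp {κ τ a b : ℝ} (hκ : 0 ≤ κ) (u : H1 a b 0 τ)
    (hu : HasUpperTrace u 0) (t : ℝ) :
    h1NormSq (transport u hu t) ≤ Real.exp (κ * (τ - t)) * h1NormSq u := by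
  have hn : 0 ≤ h1NormSq u := by unfold h1NormSq; positivity
  rcases le_total t τ with h | h
  · refine (h1NormSq_transport_le u hu t).trans (le_mul_of_one_le_left hn (Real.one_le_exp ?_))
    exact mul_nonneg hκ (sub_nonneg.2 h)
  · rw [h1NormSq_transport_eq_zero u hu (by simpa using h)]
    positivity

theorem isTransportSolution_zero (L τ : ℝ) :
    IsTransportSolution L τ (0 : H1 (-L) L 0 τ) fun _ => 0 where
  continuousOn := continuousOn_const
  initial := rfl
  equation t _ := hasDerivWithinAt_const t (Ici 0) (0 : L2Rect (-L) L 0 τ)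
  boundary t _ := by
    rw [hasUpperTrace_zero_iff]
    intro φ h1 _
    rw [integral_add_mul _ _ (continuous_pd₂ h1) h1.continuous,
      setIntegral_rect_mul_eq_inner _ (continuous_pd₂ h1),
      setIntegral_rect_mul_eq_inner _ h1.continuous]
    change inner ℝ _ (0 : L2Rect (-L) L 0 τ) + inner ℝ _ (0 : L2Rect (-L) L 0 τ) = 0
    simp

theorem isSolution_zero (L l τ : ℝ) :
    IsSolution L l τ 0 0 0 (fun _ => 0) (fun _ => 0) (fun _ => 0) := by
  have hz := isTransportSolution_zero L τ
  have ht : HasLowerTrace (0 : H1 (-L) L 0 τ) 0 := by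
    have h := hasLowerTrace_lowerTrace _ (hz.boundary 0 self_mem_Ici)
    have h0 : lowerTrace (h1Wd₂ (0 : H1 (-L) L 0 τ)) = 0 := by
      change lowerTrace (0 : L2Rect (-L) L 0 τ) = 0
      simp [lowerTrace]
    rwa [h0] at h
  refine ⟨hz, hz, fun _ => 0, fun _ => 0, fun _ _ => ht, fun _ _ => ht,
    continuousOn_const, rfl, fun φ h1 _ t _ => ?_⟩
  rw [setIntegral_rect_mul_eq_inner _ (contDiff_lap h1).continuous,
    setIntegral_seg_mul_eq_inner _ (continuous_pd₂_edge h1 l),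
    setIntegral_seg_mul_eq_inner _ (continuous_pd₂_edge h1 (-l))]
  simp only [inner_zero_right, sub_zero, add_zero]
  exact hasDerivWithinAt_const _ _ _

end TargetSystem
end

theorem proposition1 (L l τ : ℝ) (hL : 0 < L) (hl : 0 < l) (hτ : 0 < τ) :
    TargetSystem.IsSolution L l τ 0 0 0 (fun _ => 0) (fun _ => 0) (fun _ => 0) ∧
    ∃ α₂ β₂ : ℝ, 0 < α₂ ∧ 0 < β₂ ∧
      ∀ (w₀ : TargetSystem.L2Rect (-L) L (-l) l) (z₁₀ z₂₀ : TargetSystem.H1 (-L) L 0 τ),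
        TargetSystem.HasUpperTrace z₁₀ 0 → TargetSystem.HasUpperTrace z₂₀ 0 →
        ∃ (w : ℝ → TargetSystem.L2Rect (-L) L (-l) l) (z₁ z₂ : ℝ → TargetSystem.H1 (-L) L 0 τ),
          TargetSystem.IsSolution L l τ w₀ z₁₀ z₂₀ w z₁ z₂ ∧
          (∀ (w' : ℝ → TargetSystem.L2Rect (-L) L (-l) l)
            (z₁' z₂' : ℝ → TargetSystem.H1 (-L) L 0 τ),
            TargetSystem.IsSolution L l τ w₀ z₁₀ z₂₀ w' z₁' z₂' →
            Set.EqOn w' w (Set.Ici 0) ∧ Set.EqOn z₁' z₁ (Set.Ici 0) ∧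
              Set.EqOn z₂' z₂ (Set.Ici 0)) ∧
          ∀ t : ℝ, 0 ≤ t →
            ‖w t‖ ^ 2 + TargetSystem.h1NormSq (z₁ t) + TargetSystem.h1NormSq (z₂ t) ≤
              α₂ * Real.exp (-β₂ * t) *
                (‖w₀‖ ^ 2 + TargetSystem.h1NormSq z₁₀ + TargetSystem.h1NormSq z₂₀) := by
  open TargetSystem in
  have hL' : -L < L := by linarith
  have hl' : -l < l := by linarith
  have hκ := specGap_pos hL' hl'
  set κ := specGap (-L) L (-l) l
  obtain ⟨K, hK, hheat⟩ := exists_heatSolution hL' hl' hτ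
  -- The decay of `w` is guaranteed only from time `τ` on, whence `e^{2κτ}`. The heat part needs `2`
  -- and `2K` in front of the data and the transport parts add `1`, all covered by `2 + 2K`.
  refine ⟨isSolution_zero L l τ, Real.exp (2 * κ * τ) * (2 + 2 * K), 2 * κ, by positivity,
    by positivity, fun w₀ z₁₀ z₂₀ h₁ h₂ => ?_⟩
  obtain ⟨w, hw, hwb⟩ := hheat w₀ z₁₀ z₂₀
  have hz₁ := isTransportSolution_transport z₁₀ h₁
  have hz₂ := isTransportSolution_transport z₂₀ h₂
  refine ⟨w, transport z₁₀ h₁, transport z₂₀ h₂, ⟨hz₁, hz₂, inflow z₁₀, inflow z₂₀,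
    fun t ht => hasLowerTrace_inflow z₁₀ h₁ ht, fun t ht => hasLowerTrace_inflow z₂₀ h₂ ht, hw⟩,
    fun w' z₁' z₂' h' => ?_, fun t ht => ?_⟩
  · obtain ⟨hz₁', hz₂', g₁, g₂, hg₁, hg₂, hw'⟩ := h'
    have e₁ := hz₁'.eqOn hz₁
    have e₂ := hz₂'.eqOn hz₂
    refine ⟨hw'.eqOn hL' hl' hw (fun t ht ψ hψ => ?_) (fun t ht ψ hψ => ?_), e₁, e₂⟩
    -- The boundary data of a competing solution are merely some lower traces of the same `H¹`
    -- function. Agreement against smooth functions is all that uniqueness for the heat equation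
    -- uses.
    · refine (hg₁ t ht).integral_congr hτ ?_ hψ
      rw [e₁ ht]; exact hasLowerTrace_inflow z₁₀ h₁ ht
    · refine (hg₂ t ht).integral_congr hτ ?_ hψ
      rw [e₂ ht]; exact hasLowerTrace_inflow z₂₀ h₂ ht
  · have b := hwb t ht
    have b₁ := h1NormSq_transport_le_exp (κ := 2 * κ) (by positivity) z₁₀ h₁ t
    have b₂ := h1NormSq_transport_le_exp (κ := 2 * κ) (by positivity) z₂₀ h₂ t
    have n₁ : 0 ≤ h1NormSq z₁₀ := by unfold h1NormSq; positivity
    have n₂ : 0 ≤ h1NormSq z₂₀ := by unfold h1NormSq; positivity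
    have hexp : Real.exp (2 * κ * (τ - t)) = Real.exp (2 * κ * τ) * Real.exp (-(2 * κ) * t) := by
      rw [← Real.exp_add]; ring_nf
    calc _ ≤ Real.exp (2 * κ * (τ - t)) * (2 * (‖w₀‖ ^ 2 + K * (h1NormSq z₁₀ + h1NormSq z₂₀))
          + h1NormSq z₁₀ + h1NormSq z₂₀) := by linarith
      _ ≤ Real.exp (2 * κ * (τ - t)) *
          ((2 + 2 * K) * (‖w₀‖ ^ 2 + h1NormSq z₁₀ + h1NormSq z₂₀)) := by
          gcongr
          nlinarith [mul_nonneg hK (sq_nonneg ‖w₀‖)]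
      _ = _ := by rw [hexp]; ring
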